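/- **Setting (the quantum process calculus qCCS).** Let $Chan$ be a set of channel names and $Var$ a countably infinite set of quantum variables. Each variable $x$ has a type, which determines a nonzero finite-dimensional complex Hilbert space $\mathcal H_x$, and for each $x$ there are infinitely many variables of the same type as $x$. Put $\mathcal H_X=\bigotimes_{x\in X}\mathcal H_x$ for $X\subseteq Var$, and $\mathcal H=\mathcal H_{Var}$ (the Hilbert space with the product basis vectors $\bigotimes_x|s_x\rangle$, where all but finitely many $s_x$ are $0$, as orthonormal basis). $\mathcal D(\mathcal H)$ is the set of partial density operators on $\mathcal H$ (positive, trace $\le 1$). For finite $X$, a super-operator on $\mathcal H_X$ is a completely positive linear map on the operators on $\mathcal H_X$ which does not increase the trace of partial density operators. *Processes* are given by $$P::=A(\widetilde x)\mid \mathbf{nil}\mid \tau.P\mid \mathcal E[X].P\mid c?x.P\mid c!x.P\mid P+P\mid P\|P\mid P\backslash L,$$ where $A$ is a process constant scheme with an arity, $\widetilde x$ is a tuple of distinct variables of that length, $X\subseteq Var$ is finite, $\mathcal E$ is a super-operator on $\mathcal H_X$, and $L\subseteq Chan$; it is required that $x\notin fv(P)$ in $c!x.P$, and $fv(P)\cap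 fv(Q)=\emptyset$ in $P\|Q$. Here the free variables are $fv(A(\widetilde x))=\{\widetilde x\}$, $fv(\mathbf{nil})=\emptyset$, $fv(\tau.P)=fv(P\backslash L)=fv(P)$, $fv(\mathcal E[X].P)=fv(P)\cup X$, $fv(c?x.P)=fv(P)\setminus\{x\}$, $fv(c!x.P)=fv(P)\cup\{x\}$, $fv(P+Q)=fv(P\|Q)=fv(P)\cup fv(Q)$. Each scheme $A$ has one defining equation $A(\widetilde x)\stackrel{def}{=}P$, with $fv(P)\subseteq\{\widetilde x\}$. A substitution $f$ is a type-preserving injection $Var\to Var$ which moves only finitely many variables; $Pf$ is the capture-avoiding simultaneous substitution of $f(x)$ for the free occurrences of $x$, for all $x$, where $\mathcal E[X]$ becomes $(f\circ\mathcal E\circ f^{-1})[f(X)]$; $Pf$ is determined up to the names of bound variables. $P\{y/x\}$, for $x,y$ of the same type, is $Pf$ for the $f$ that exchanges $x$ and $y$. *Actions* are $\tau$, $\mathcal E[X]$, $c?x$ and $c!x$. *Configurations* $\langle P,\rho\rangle$ consist of a process and $\rho\in\mathcal D(\mathcal H)$. Transitions are generated by: $\langle\tau.P,\rho\rangle\stackrel{\tau}{\to}\langle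 P,\rho\rangle$; $\langle\mathcal E[X].P,\rho\rangle\stackrel{\mathcal E[X]}{\longrightarrow}\langle P,(\mathcal E\otimes\mathcal I_{Var\setminus X})(\rho)\rangle$; $\langle c?x.P,\rho\rangle\stackrel{c?y}{\to}\langle P\{y/x\},\rho\rangle$ for $y\notin fv(c?x.P)$; $\langle c!x.P,\rho\rangle\stackrel{c!x}{\to}\langle P,\rho\rangle$; $P+Q$ has the transitions of $P$ and those of $Q$; if $\langle P,\rho\rangle\stackrel{\alpha}{\to}\langle P',\rho'\rangle$, then $\langle P\|Q,\rho\rangle\stackrel{\alpha}{\to}\langle P'\|Q,\rho'\rangle$ provided that $\alpha$ is not an input, or that $\alpha=c?x$ with $x\notin fv(Q)$ (and symmetrically); if $\langle P,\rho\rangle\stackrel{c?x}{\to}\langle P',\rho\rangle$ and $\langle Q,\rho\rangle\stackrel{c!x}{\to}\langle Q',\rho\rangle$, then $\langle P\|Q,\rho\rangle\stackrel{\tau}{\to}\langle P'\|Q',\rho\rangle$ (and symmetrically); if $\langle P,\rho\rangle\stackrel{\alpha}{\to}\langle P',\rho'\rangle$ and the channel name of $\alpha$, if any, is not in $L$, then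 $\langle P\backslash L,\rho\rangle\stackrel{\alpha}{\to}\langle P'\backslash L,\rho'\rangle$; and $A(\widetilde y)$ has the transitions of $P\{\widetilde y/\widetilde x\}$, i.e. of $Pf$ for the substitutions $f$ with $f(x_i)=y_i$ for all $i$, when $A(\widetilde x)\stackrel{def}{=}P$. A symmetric relation $\mathcal R$ on configurations is a *strong bisimulation* if $\langle P,\rho\rangle\mathcal R\langle Q,\sigma\rangle$ implies: (i) if $\langle P,\rho\rangle\stackrel{\alpha}{\to}\langle P',\rho'\rangle$ and $\alpha$ is not an input, then $\langle Q,\sigma\rangle\stackrel{\alpha}{\to}\langle Q',\sigma'\rangle$ and $\langle P',\rho'\rangle\mathcal R\langle Q',\sigma'\rangle$ for some $Q',\sigma'$; (ii) if $\langle P,\rho\rangle\stackrel{c?x}{\to}\langle P',\rho\rangle$ and $x\notin fv(P)\cup fv(Q)$, then for some $Q'$, $\langle Q,\sigma\rangle\stackrel{c?x}{\to}\langle Q',\sigma\rangle$ and $\langle P'\{y/x\},\rho\rangle\mathcal R\langle Q'\{y/x\},\sigma\rangle$ for all $y\notin(fv(P')\cup fv(Q'))\setminus\{x\}$ of the type of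 $x$. Processes are *strongly bisimilar*, $P\sim Q$, if for each $\rho\in\mathcal D(\mathcal H)$ some strong bisimulation relates $\langle P,\rho\rangle$ and $\langle Q,\rho\rangle$. For $n\ge1$ and super-operators $\mathcal E^{(i)}$ on $\mathcal H_{X_i}$ ($1\le i\le n$, $X_i$ finite), their *composed operation* is $\mathcal E[X]$ with $X=\bigcup_{i=1}^nX_i$ and $$\mathcal E=(\mathcal E^{(n)}\otimes\mathcal I_{X\setminus X_n})\circ\cdots\circ(\mathcal E^{(1)}\otimes\mathcal I_{X\setminus X_1}).$$ A string of actions reduces to another if the latter arises by replacing a substring $\mathcal E^{(1)}[X_1]\cdots\mathcal E^{(n)}[X_n]$ by its composed operation $\mathcal E[X]$. *Operation reduction* $P\to P'$ between processes is the least reflexive and transitive relation that contains $\alpha_1.\cdots.\alpha_m.P\to\beta_1.\cdots.\beta_k.P$ whenever the string $\alpha_1\cdots\alpha_m$ reduces to $\beta_1\cdots\beta_k$, and that is closed under prefixing, under $+$ and $\|$ in either argument, and under restriction. Write $P\simeq Q$ if there are $P_1,P_2,Q_1,Q_2$ with $P\sim P_1\to P_2$, $Q\sim Q_1\to Q_2$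 and $P_2\sim Q_2$. *Strong reduction-bisimilarity* $\stackrel{\ast}{\sim}$ is the transitive closure of $\simeq$. **Theorem 5.1.** 1. If $P\sim Q$ then $P\stackrel{\ast}{\sim}Q$. 2. If $P\to P'$ then $P\stackrel{\ast}{\sim}P'$. In particular, if $\mathcal E[X]$ is the composed operation of $\mathcal E^{(1)}[X_1],\dots,\mathcal E^{(n)}[X_n]$ ($n\ge 1$), then (a) $\mathcal E^{(1)}[X_1].\cdots.\mathcal E^{(n)}[X_n].P\stackrel{\ast}{\sim}\mathcal E[X].P$ for every process $P$; (b) $A(\widetilde x)\stackrel{\ast}{\sim}\mathcal E[X].A(\widetilde x)$ if the process constant scheme $A$ is defined by $A(\widetilde x)\stackrel{def}{=}\mathcal E^{(1)}[X_1].\cdots.\mathcal E^{(n)}[X_n].A(\widetilde x)$, where $\{\widetilde x\}=\bigcup_{i=1}^nX_i$. 3. $\stackrel{\ast}{\sim}$ is an equivalence relation on processes. 4. If $P\stackrel{\ast}{\sim}Q$ then (a) $\alpha.P\stackrel{\ast}{\sim}\alpha.Q$ for every action $\alpha$ for which both sides are processes; (b) $P+R\stackrel{\ast}{\sim}Q+R$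 for every process $R$; (c) $P\|R\stackrel{\ast}{\sim}Q\|R$ for every process $R$ for which both sides are processes; (d) $P\backslash L\stackrel{\ast}{\sim}Q\backslash L$ for every $L\subseteq Chan$. -/

import Mathlib

open scoped ComplexOrder InnerProductSpace

universe u

namespace QCCS

/-- The data over which the calculus is built: channel names, process constant schemes with their
arities, countably many quantum variables, and the type of each variable. A type `t` has the
state space `ℂ ^ (dim t)`, and each type is carried by infinitely many variables. -/
structure Signature where
  Chan : Type u
  Const : Type u
  arity : Const → ℕ
  Var : Type u
  [decEqVar : DecidableEq Var]
  [countableVar : Countable Var]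
  Ty : Type u
  ty : Var → Ty
  dim : Ty → ℕ
  dim_pos : ∀ t, 0 < dim t
  infiniteVar : Infinite Var
  infinite_type : ∀ x, {y | ty y = ty x}.Infinite

attribute [instance] Signature.decEqVar Signature.countableVar Signature.infiniteVar

section Operators

variable {I R J K : Type*}

/-- `Φ ⊗ I_R`, for a linear map `Φ` on the operators on `ℂ^I`, acting on operators on `ℂ^J`, where
`e : I × R ≃ J` splits the product basis of `ℂ^J = ℂ^I ⊗ ℂ^R`: the map `Φ` is applied to each of
the blocks `(⟨r| ⊗ id) A (|r'⟩ ⊗ id)`. -/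
noncomputable def amplify (Φ : Matrix I I ℂ →ₗ[ℂ] Matrix I I ℂ) (e : I × R ≃ J) :
    Matrix J J ℂ →ₗ[ℂ] Matrix J J ℂ where
  toFun A := Matrix.of fun s t =>
    Φ (Matrix.of fun a b => A (e (a, (e.symm s).2)) (e (b, (e.symm t).2)))
      (e.symm s).1 (e.symm t).1
  map_add' A B := by
    ext s t
    exact congrFun (congrFun (map_add Φ
      (Matrix.of fun a b => A (e (a, (e.symm s).2)) (e (b, (e.symm t).2)))
      (Matrix.of fun a b => B (e (a, (e.symm s).2)) (e (b, (e.symm t).2)))) _) _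
  map_smul' c A := by
    ext s t
    exact congrFun (congrFun (map_smul Φ c
      (Matrix.of fun a b => A (e (a, (e.symm s).2)) (e (b, (e.symm t).2)))) _) _

/-- Super-operators on the finite-dimensional space `ℂ^I`: linear maps on operators that do not
increase the trace of partial density operators and are completely positive (`Φ ⊗ I` preserves
positivity for every finite-dimensional ancilla `ℂ^n`). -/
structure IsSuperOp [Fintype I] (Φ : Matrix I I ℂ →ₗ[ℂ] Matrix I I ℂ) : Prop where
  trace_le : ∀ ρ : Matrix I I ℂ, ρ.PosSemidef → ρ.trace.re ≤ 1 → (Φ ρ).trace.re ≤ ρ.trace.re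
  completelyPositive : ∀ (n : ℕ) (A : Matrix (I × Fin n) (I × Fin n) ℂ),
    A.PosSemidef → (amplify Φ (Equiv.refl (I × Fin n)) A).PosSemidef

theorem posSemidef_of_fin {B : Matrix J J ℂ}
    (h : ∀ (n : ℕ) (g : Fin n → J), (B.submatrix g g).PosSemidef) : B.PosSemidef := by
  refine ⟨?_, fun x => ?_⟩
  · ext i j
    have := (h 2 ![i, j]).1.apply 0 1
    simpa using this
  · let g : Fin x.support.card → J := fun i => (x.support.equivFin.symm i : J)
    have := (h _ g).2 (Finsupp.equivFunOnFinite.symm (fun i => x (g i)))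
    have key : ∀ F : J → ℂ, ∑ i, F (g i) = ∑ s ∈ x.support, F s := by
      intro F
      rw [← Finset.sum_coe_sort x.support]
      exact Equiv.sum_comp x.support.equivFin.symm (fun s : x.support => F s)
    rw [Finsupp.sum_fintype _ _ (by simp)] at this
    simp only [Finsupp.sum_fintype, Finsupp.equivFunOnFinite_symm_apply_apply, Matrix.submatrix_apply,
      mul_zero, implies_true] at this
    rw [Finsupp.sum]
    simp only [Finsupp.sum]
    rw [← key]
    simp only [← key (fun s => star (x (g _)) * B (g _) s * x s)]
    exact this

theorem amplify_posSemidef [Fintype I] {Φ : Matrix I I ℂ →ₗ[ℂ] Matrix I I ℂ} (hΦ : IsSuperOp Φ)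
    (e : I × R ≃ J) {A : Matrix J J ℂ} (hA : A.PosSemidef) : (amplify Φ e A).PosSemidef := by
  refine posSemidef_of_fin fun n g => ?_
  have h := hΦ.completelyPositive n _
    (hA.submatrix fun p : I × Fin n => e (p.1, (e.symm (g p.2)).2))
  exact h.submatrix fun i => ((e.symm (g i)).1, i)

theorem amplify_trace_fiber [Fintype I] {Φ : Matrix I I ℂ →ₗ[ℂ] Matrix I I ℂ} (hΦ : IsSuperOp Φ)
    (e : I × R ≃ J) {A : Matrix J J ℂ} (hA : A.PosSemidef) (r : R)
    (h1 : ∑ a, (A (e (a, r)) (e (a, r))).re ≤ 1) :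
    ∑ a, (amplify Φ e A (e (a, r)) (e (a, r))).re ≤ ∑ a, (A (e (a, r)) (e (a, r))).re := by
  have h := hΦ.trace_le _ (hA.submatrix fun a => e (a, r))
  simp only [Matrix.trace, Matrix.diag_apply, Matrix.submatrix_apply, Complex.re_sum] at h
  refine le_trans (le_of_eq ?_) (h h1)
  refine Finset.sum_congr rfl fun a _ => ?_
  simp only [amplify, LinearMap.coe_mk, AddHom.coe_mk, Matrix.of_apply, Equiv.symm_apply_apply]
  rfl

theorem diag_re_nonneg {A : Matrix J J ℂ} (hA : A.PosSemidef) (s : J) : 0 ≤ (A s s).re :=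
  (Complex.nonneg_iff.mp hA.diag_nonneg).1

theorem amplify_isSuperOp [Fintype I] [Fintype R] [Fintype J]
    {Φ : Matrix I I ℂ →ₗ[ℂ] Matrix I I ℂ} (hΦ : IsSuperOp Φ) (e : I × R ≃ J) :
    IsSuperOp (amplify Φ e) where
  trace_le A hA h1 := by
    have key : ∀ F : J → ℝ, ∑ s, F s = ∑ r, ∑ a, F (e (a, r)) := fun F => by
      rw [← Equiv.sum_comp e, Fintype.sum_prod_type_right]
    simp only [Matrix.trace, Matrix.diag_apply, Complex.re_sum] at h1 ⊢
    rw [key] at h1 ⊢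
    rw [key (fun s => (A s s).re)]
    refine Finset.sum_le_sum fun r _ => amplify_trace_fiber hΦ e hA r (le_trans ?_ h1)
    exact Finset.single_le_sum (f := fun r => ∑ a, (A (e (a, r)) (e (a, r))).re)
      (fun r _ => Finset.sum_nonneg fun a _ => diag_re_nonneg hA _) (Finset.mem_univ r)
  completelyPositive n A hA := by
    have h := amplify_posSemidef hΦ
      ((Equiv.prodAssoc I R (Fin n)).symm.trans (Equiv.prodCongr e (Equiv.refl _))) hA
    exact h

/-- Transport of a linear map on operators along a bijection of bases: `e ∘ Φ ∘ e⁻¹`. -/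
noncomputable def conj (e : I ≃ J) (Φ : Matrix I I ℂ →ₗ[ℂ] Matrix I I ℂ) :
    Matrix J J ℂ →ₗ[ℂ] Matrix J J ℂ :=
  (Matrix.reindexLinearEquiv ℂ ℂ e e).toLinearMap ∘ₗ Φ ∘ₗ
    (Matrix.reindexLinearEquiv ℂ ℂ e.symm e.symm).toLinearMap

theorem conj_isSuperOp [Fintype I] [Fintype J] {Φ : Matrix I I ℂ →ₗ[ℂ] Matrix I I ℂ}
    (hΦ : IsSuperOp Φ) (e : I ≃ J) : IsSuperOp (conj e Φ) where
  trace_le A hA h1 := by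
    have key : ∀ F : J → ℂ, ∑ a, F (e a) = ∑ s, F s := fun F => Equiv.sum_comp e F
    have h := hΦ.trace_le _ (hA.submatrix e)
    have h2 : (A.submatrix e e).trace = A.trace := key fun s => A s s
    rw [h2] at h
    refine le_trans (le_of_eq ?_) (h h1)
    congr 1
    rw [Matrix.trace, ← key]
    simp only [conj, LinearMap.comp_apply, LinearEquiv.coe_coe, Matrix.coe_reindexLinearEquiv,
      Matrix.reindex_apply, Matrix.diag_apply, Matrix.submatrix_apply, Equiv.symm_apply_apply,
      Equiv.symm_symm]
    rfl
  completelyPositive n A hA := by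
    have h := hΦ.completelyPositive n _
      (hA.submatrix fun p : I × Fin n => ((e p.1, p.2) : J × Fin n))
    exact h.submatrix fun p : J × Fin n => ((e.symm p.1, p.2) : I × Fin n)

theorem comp_isSuperOp [Fintype I] {Φ Ψ : Matrix I I ℂ →ₗ[ℂ] Matrix I I ℂ}
    (hΦ : IsSuperOp Φ) (hΨ : IsSuperOp Ψ) : IsSuperOp (Φ ∘ₗ Ψ) where
  trace_le A hA h1 := by
    have hp : (Ψ A).PosSemidef :=
      amplify_posSemidef hΨ (Equiv.prodPUnit.{0} I : I × PUnit ≃ I) hA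
    exact (hΦ.trace_le _ hp ((hΨ.trace_le _ hA h1).trans h1)).trans (hΨ.trace_le _ hA h1)
  completelyPositive n A hA := hΦ.completelyPositive n _ (hΨ.completelyPositive n A hA)

theorem id_isSuperOp [Fintype I] :
    IsSuperOp (LinearMap.id : Matrix I I ℂ →ₗ[ℂ] Matrix I I ℂ) where
  trace_le _ _ _ := le_rfl
  completelyPositive _ _ hA := hA


/-- The Hilbert space `ℓ²(J)` with its computational basis `ket s`, `s : J`. -/
abbrev Ell2 (J : Type*) : Type _ := lp (fun _ : J => ℂ) 2

open Classical in
/-- The basis vector `|s⟩`. -/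
noncomputable def ket (s : J) : Ell2 J := lp.single 2 s 1

theorem inner_ket (s : J) (ψ : Ell2 J) : ⟪ket s, ψ⟫_ℂ = ψ s := by
  classical
  rw [ket, lp.inner_single_left]
  simp

theorem ket_apply (s t : J) [Decidable (s = t)] : (ket t : Ell2 J) s = if s = t then 1 else 0 := by
  classical
  rw [ket, lp.single_apply]
  by_cases h : s = t
  · subst h; simp
  · simp [h]

theorem orthonormal_ket : Orthonormal ℂ (ket : J → Ell2 J) := by
  classical
  rw [orthonormal_iff_ite]
  intro s t
  rw [inner_ket, ket_apply]

/-- The isometry `φ ↦ |a⟩ ⊗ φ` from `ℓ²(R)` into `ℓ²(J) = ℂ^I ⊗ ℓ²(R)`; see `tensorKet_ket`. -/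
noncomputable def tensorKet (e : I × R ≃ J) (a : I) : Ell2 R →ₗᵢ[ℂ] Ell2 J :=
  ((orthonormal_ket (J := J)).comp (fun r => e (a, r))
    (fun _ _ h => (Prod.mk.inj (e.injective h)).2)).orthogonalFamily.linearIsometry

theorem tensorKet_ket (e : I × R ≃ J) (a : I) (r : R) :
    tensorKet e a (ket r) = ket (e (a, r)) := by
  classical
  rw [tensorKet, ket]
  refine (OrthogonalFamily.linearIsometry_apply_single (G := fun _ : R => ℂ) _ (1 : ℂ)).trans ?_
  simp

/-- `Φ ⊗ I_R` on the bounded operators on `ℓ²(J) = ℂ^I ⊗ ℓ²(R)`: writing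
`ρ = ∑ c d, |c⟩⟨d| ⊗ ρ_cd` with `ρ_cd = (⟨c| ⊗ id) ρ (|d⟩ ⊗ id)`, this is
`∑ c d, Φ(|c⟩⟨d|) ⊗ ρ_cd`; see `entries_cylinder` for its matrix entries. -/
noncomputable def cylinder [Fintype I] [DecidableEq I] (Φ : Matrix I I ℂ →ₗ[ℂ] Matrix I I ℂ)
    (e : I × R ≃ J) (ρ : Ell2 J →L[ℂ] Ell2 J) : Ell2 J →L[ℂ] Ell2 J :=
  ∑ a, ∑ b, ∑ c, ∑ d, Φ (Matrix.single c d 1) a b •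
    ((tensorKet e a).toContinuousLinearMap ∘L
      ((tensorKet e c).toContinuousLinearMap.adjoint ∘L ρ ∘L
        (tensorKet e d).toContinuousLinearMap) ∘L
      (tensorKet e b).toContinuousLinearMap.adjoint)

/-- The matrix entries `⟨s|ρ|t⟩`. -/
noncomputable def entries (ρ : Ell2 J →L[ℂ] Ell2 J) : Matrix J J ℂ :=
  Matrix.of fun s t => ⟪ket s, ρ (ket t)⟫_ℂ

theorem adjoint_tensorKet_ket [DecidableEq I] (e : I × R ≃ J) (a b : I) (r : R) :
    (tensorKet e a).toContinuousLinearMap.adjoint (ket (e (b, r))) =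
      if b = a then ket r else 0 := by
  classical
  ext r'
  rw [← inner_ket, ContinuousLinearMap.adjoint_inner_right]
  simp only [LinearIsometry.coe_toContinuousLinearMap, tensorKet_ket]
  rw [inner_ket, ket_apply]
  by_cases h : b = a
  · subst h
    simp [ket_apply]
  · have : ¬ a = b := fun h' => h h'.symm
    simp [h, this]

theorem entries_cylinder [Fintype I] [DecidableEq I] (Φ : Matrix I I ℂ →ₗ[ℂ] Matrix I I ℂ)
    (e : I × R ≃ J) (ρ : Ell2 J →L[ℂ] Ell2 J) :
    entries (cylinder Φ e ρ) = amplify Φ e (entries ρ) := by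
  ext s t
  obtain ⟨⟨a, r⟩, rfl⟩ := e.surjective s
  obtain ⟨⟨b, r'⟩, rfl⟩ := e.surjective t
  have hL : ∀ (a' : I) (φ : Ell2 R), ⟪ket (e (a, r)), tensorKet e a' φ⟫_ℂ =
      if a = a' then ⟪ket r, φ⟫_ℂ else 0 := by
    intro a' φ
    have := ContinuousLinearMap.adjoint_inner_left (tensorKet e a').toContinuousLinearMap φ
      (ket (e (a, r)))
    rw [adjoint_tensorKet_ket] at this
    rw [LinearIsometry.coe_toContinuousLinearMap] at this
    rw [← this]
    split_ifs <;> simp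
  have hin : ∀ c d : I, ⟪ket r, (tensorKet e c).toContinuousLinearMap.adjoint
      (ρ (tensorKet e d (ket r')))⟫_ℂ = entries ρ (e (c, r)) (e (d, r')) := by
    intro c d
    rw [ContinuousLinearMap.adjoint_inner_right, LinearIsometry.coe_toContinuousLinearMap,
      tensorKet_ket, tensorKet_ket]
    rfl
  have hA : (Matrix.of fun c d => entries ρ (e (c, r)) (e (d, r'))) =
      ∑ c, ∑ d, entries ρ (e (c, r)) (e (d, r')) • Matrix.single c d (1 : ℂ) := by
    conv_lhs => rw [Matrix.matrix_eq_sum_single (Matrix.of fun c d =>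
      entries ρ (e (c, r)) (e (d, r')))]
    simp [Matrix.smul_single]
  have hR : amplify Φ e (entries ρ) (e (a, r)) (e (b, r')) =
      Φ (Matrix.of fun c d => entries ρ (e (c, r)) (e (d, r'))) a b := by
    simp only [amplify, LinearMap.coe_mk, AddHom.coe_mk, Matrix.of_apply, Equiv.symm_apply_apply]
  rw [hR, hA]
  simp only [map_sum, map_smul, Matrix.sum_apply, Matrix.smul_apply]
  simp only [entries, cylinder, Matrix.of_apply, sum_apply, inner_sum,
    smul_apply, inner_smul_right, ContinuousLinearMap.comp_apply,
    adjoint_tensorKet_ket, LinearIsometry.coe_toContinuousLinearMap, hL]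
  rw [Finset.sum_eq_single a, Finset.sum_eq_single b]
  · refine Finset.sum_congr rfl fun c _ => Finset.sum_congr rfl fun d _ => ?_
    simp only [if_true, hin]
    rw [smul_eq_mul, mul_comm]
    rfl
  · intro b' _ hb
    simp [Ne.symm hb]
  · simp
  · intro a' _ ha
    simp [Ne.symm ha]
  · simp

theorem isPositive_iff_entries (ρ : Ell2 J →L[ℂ] Ell2 J) :
    ρ.IsPositive ↔ (entries ρ).PosSemidef := by
  classical
  have hsum : ∀ x : J →₀ ℂ,
      ⟪ρ (x.sum fun s c => c • (ket s : Ell2 J)), x.sum fun s c => c • (ket s : Ell2 J)⟫_ℂ =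
      star (x.sum fun i xi => x.sum fun j xj => star xi * entries ρ i j * xj) := by
    intro x
    rw [← inner_conj_symm]
    rw [RCLike.star_def]
    refine congrArg _ ?_
    simp only [Finsupp.sum, map_sum ρ, map_smul ρ, sum_inner, inner_sum, inner_smul_left,
      inner_smul_right, Finset.mul_sum]
    rw [Finset.sum_comm]
    refine Finset.sum_congr rfl fun i _ => Finset.sum_congr rfl fun j _ => ?_
    simp only [entries, Matrix.of_apply]
    ring
  constructor
  · intro h
    refine ⟨?_, fun x => ?_⟩
    · ext s t
      simp only [Matrix.conjTranspose_apply, entries, Matrix.of_apply, RCLike.star_def,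
        inner_conj_symm]
      exact h.inner_left_eq_inner_right _ _
    · have := h.inner_nonneg_left (x.sum fun s c => c • (ket s : Ell2 J))
      rw [hsum, star_nonneg_iff] at this
      exact this
  · intro h
    rw [ContinuousLinearMap.isPositive_iff_complex]
    have hc : IsClosed {z : ℂ | ((z.re : ℝ) : ℂ) = z ∧ 0 ≤ z.re} :=
      (isClosed_eq (by fun_prop) continuous_id).inter
        (isClosed_le continuous_const Complex.continuous_re)
    intro ψ
    have ht : Filter.Tendsto (fun F : Finset J => ∑ s ∈ F, ψ s • (ket s : Ell2 J))
        Filter.atTop (nhds ψ) := by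
      have := lp.hasSum_single (p := 2) (by norm_num) ψ
      refine this.congr fun F => Finset.sum_congr rfl fun s _ => ?_
      rw [ket, ← lp.single_smul]
      simp
    have hcont : Continuous fun φ : Ell2 J => ⟪ρ φ, φ⟫_ℂ := by fun_prop
    refine hc.mem_of_tendsto ((hcont.tendsto ψ).comp ht) (Filter.Eventually.of_forall fun F => ?_)
    let x : J →₀ ℂ := Finsupp.onFinset F (fun s => if s ∈ F then ψ s else 0) (by
      intro s hs
      by_contra hF
      simp [hF] at hs)
    have hx : (x.sum fun s c => c • (ket s : Ell2 J)) = ∑ s ∈ F, ψ s • ket s := by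
      rw [Finsupp.onFinset_sum _ (by simp)]
      exact Finset.sum_congr rfl fun s hs => by simp [hs]
    have h2 := h.2 x
    rw [← star_nonneg_iff, ← hsum, hx] at h2
    obtain ⟨h3, h4⟩ := Complex.nonneg_iff.mp h2
    exact ⟨Complex.ext (by simp) (by simpa using h4), h3⟩

/-- Partial density operators: positive operators of trace at most one. -/
structure IsPartialDensity (ρ : Ell2 J →L[ℂ] Ell2 J) : Prop where
  positive : ρ.IsPositive
  summable : Summable fun s => (⟪ket s, ρ (ket s)⟫_ℂ).re
  trace_le_one : ∑' s, (⟪ket s, ρ (ket s)⟫_ℂ).re ≤ 1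

theorem cylinder_isPartialDensity [Fintype I] [DecidableEq I]
    {Φ : Matrix I I ℂ →ₗ[ℂ] Matrix I I ℂ} (hΦ : IsSuperOp Φ) (e : I × R ≃ J)
    {ρ : Ell2 J →L[ℂ] Ell2 J} (hρ : IsPartialDensity ρ) :
    IsPartialDensity (cylinder Φ e ρ) := by
  have hA : (entries ρ).PosSemidef := (isPositive_iff_entries ρ).mp hρ.positive
  have hB : (amplify Φ e (entries ρ)).PosSemidef := amplify_posSemidef hΦ e hA
  have hpos : (cylinder Φ e ρ).IsPositive := by
    rw [isPositive_iff_entries, entries_cylinder]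
    exact hB
  have hs : Summable fun s => (entries ρ s s).re := hρ.summable
  have ht : ∑' s, (entries ρ s s).re ≤ 1 := hρ.trace_le_one
  have hdiag : ∀ s, (⟪ket s, cylinder Φ e ρ (ket s)⟫_ℂ).re =
      (amplify Φ e (entries ρ) s s).re := fun s => by
    rw [← entries_cylinder]; rfl
  have hfin : ∀ F : Finset J, ∑ s ∈ F, (amplify Φ e (entries ρ) s s).re ≤
      ∑' s, (entries ρ s s).re := by
    classical
    intro F
    let T : Finset R := F.image fun s => (e.symm s).2
    let G : Finset J := ((Finset.univ : Finset I) ×ˢ T).map e.toEmbedding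
    have hFG : F ⊆ G := fun s hs => by
      simp only [G, Finset.mem_map_equiv, Finset.mem_product, Finset.mem_univ, true_and, T]
      exact Finset.mem_image_of_mem _ hs
    have hG : ∀ f : J → ℝ, ∑ s ∈ G, f s = ∑ r ∈ T, ∑ a, f (e (a, r)) := fun f => by
      rw [Finset.sum_map, Finset.sum_product_right]
      rfl
    have hle : ∀ H : Finset J, ∑ s ∈ H, (entries ρ s s).re ≤ ∑' s, (entries ρ s s).re :=
      fun H => hs.sum_le_tsum H fun s _ => diag_re_nonneg hA s
    calc ∑ s ∈ F, (amplify Φ e (entries ρ) s s).re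
        ≤ ∑ s ∈ G, (amplify Φ e (entries ρ) s s).re :=
          Finset.sum_le_sum_of_subset_of_nonneg hFG fun s _ _ => diag_re_nonneg hB s
      _ = ∑ r ∈ T, ∑ a, (amplify Φ e (entries ρ) (e (a, r)) (e (a, r))).re := hG _
      _ ≤ ∑ r ∈ T, ∑ a, (entries ρ (e (a, r)) (e (a, r))).re := by
          refine Finset.sum_le_sum fun r _ => amplify_trace_fiber hΦ e hA r ?_
          have := (hle (Finset.univ.map
            ⟨fun a => e (a, r), fun _ _ h => (Prod.mk.inj (e.injective h)).1⟩)).trans ht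
          rwa [Finset.sum_map] at this
      _ = ∑ s ∈ G, (entries ρ s s).re := (hG fun s => (entries ρ s s).re).symm
      _ ≤ ∑' s, (entries ρ s s).re := hle G
  refine ⟨hpos, ?_, ?_⟩
  · simp only [hdiag]
    exact summable_of_sum_le (fun s => diag_re_nonneg hB s) hfin
  · simp only [hdiag]
    exact (Real.tsum_le_of_sum_le (fun s => diag_re_nonneg hB s) hfin).trans ht

end Operators

section Calculus

variable (S : Signature.{u})

/-- The labels of the product basis of `H_Y = ⨂ x ∈ Y, ℂ ^ (dim (ty x))`: one basis label
`s x < dim (ty x)` for each `x ∈ Y`, all but finitely many of them `0`. Outside `Y` the entries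
are `0` by convention. -/
def Label (Y : Set S.Var) : Type u :=
  {s : S.Var →₀ ℕ // (∀ x, s x < S.dim (S.ty x)) ∧ ∀ x, x ∉ Y → s x = 0}

instance (Y : Set S.Var) : DecidableEq (Label S Y) :=
  inferInstanceAs (DecidableEq {s : S.Var →₀ ℕ //
    (∀ x, s x < S.dim (S.ty x)) ∧ ∀ x, x ∉ Y → s x = 0})

theorem label_finite {Y : Set S.Var} (hY : Y.Finite) : Finite (Label S Y) := by
  have := hY.to_subtype
  refine Finite.of_injective
    (fun (s : Label S Y) (x : Y) => (⟨s.1 x, s.2.1 x⟩ : Fin (S.dim (S.ty x)))) ?_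
  intro s t h
  apply Subtype.ext
  ext x
  by_cases hx : x ∈ Y
  · exact congrArg Fin.val (congrFun h ⟨x, hx⟩)
  · rw [s.2.2 x hx, t.2.2 x hx]

noncomputable instance (X : Finset S.Var) : Fintype (Label S (X : Set S.Var)) :=
  haveI := label_finite S X.finite_toSet
  Fintype.ofFinite _

variable {S}

open Classical in
/-- `H_X ⊗ H_{Y∖X} = H_Y` on basis labels, for `X ⊆ Y`: `|a⟩ ⊗ |b⟩ = |a + b⟩`. -/
noncomputable def splitLabel {X Y : Set S.Var} (h : X ⊆ Y) :
    Label S X × Label S (Y \ X) ≃ Label S Y where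
  toFun p := ⟨p.1.1 + p.2.1, by
    refine ⟨fun x => ?_, fun x hx => ?_⟩
    · by_cases hx : x ∈ X
      · have : p.2.1 x = 0 := p.2.2.2 x fun h' => h'.2 hx
        simpa [this] using p.1.2.1 x
      · have : p.1.1 x = 0 := p.1.2.2 x hx
        simpa [this] using p.2.2.1 x
    · have h1 : p.1.1 x = 0 := p.1.2.2 x fun h' => hx (h h')
      have h2 : p.2.1 x = 0 := p.2.2.2 x fun h' => hx h'.1
      simp [h1, h2]⟩
  invFun s :=
    (⟨s.1.filter (· ∈ X), fun x => by
        by_cases hx : x ∈ X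
        · simpa [Finsupp.filter_apply, hx] using s.2.1 x
        · simpa [Finsupp.filter_apply, hx] using S.dim_pos _,
      fun x hx => by simp [hx]⟩,
     ⟨s.1.filter (¬ · ∈ X), fun x => by
        by_cases hx : x ∈ X
        · simpa [Finsupp.filter_apply, hx] using S.dim_pos _
        · simpa [Finsupp.filter_apply, hx] using s.2.1 x,
      fun x hx => by
        by_cases h' : x ∈ X
        · simp [h']
        · simpa [Finsupp.filter_apply, h'] using s.2.2 x fun hy => hx ⟨hy, h'⟩⟩)
  left_inv p := by
    refine Prod.ext (Subtype.ext ?_) (Subtype.ext ?_) <;> ext x <;> by_cases hx : x ∈ X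
    · have : p.2.1 x = 0 := p.2.2.2 x fun h' => h'.2 hx
      simp [hx, this]
    · have : p.1.1 x = 0 := p.1.2.2 x hx
      simp [hx, this]
    · have : p.2.1 x = 0 := p.2.2.2 x fun h' => h'.2 hx
      simp [hx, this]
    · have : p.1.1 x = 0 := p.1.2.2 x hx
      simp [hx, this]
  right_inv s := Subtype.ext (Finsupp.filter_add_filter_not _ _)

variable (S) in
/-- Partial density operators on the state space `H = H_Var` of the whole environment. -/
structure DensityOp where
  op : Ell2 (Label S Set.univ) →L[ℂ] Ell2 (Label S Set.univ)
  isPartialDensity : IsPartialDensity op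

variable (S) in
/-- Super-operators on `H_X`, for a finite set `X` of variables. -/
structure SuperOp (X : Finset S.Var) where
  map : Matrix (Label S (X : Set S.Var)) (Label S (X : Set S.Var)) ℂ →ₗ[ℂ]
    Matrix (Label S (X : Set S.Var)) (Label S (X : Set S.Var)) ℂ
  isSuperOp : IsSuperOp map

/-- The cylindric extension `E_X = E ⊗ I_{Var∖X}`, acting on the states of the environment. -/
noncomputable def SuperOp.apply {X : Finset S.Var} (E : SuperOp S X) (ρ : DensityOp S) :
    DensityOp S :=
  ⟨cylinder E.map (splitLabel (Set.subset_univ (X : Set S.Var))) ρ.op,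
    cylinder_isPartialDensity E.isSuperOp _ ρ.isPartialDensity⟩

/-- The extension `E ⊗ I_{Y∖X}` to a larger finite set `Y` of variables. -/
noncomputable def SuperOp.extend {X Y : Finset S.Var} (h : X ⊆ Y) (E : SuperOp S X) :
    SuperOp S Y :=
  ⟨amplify E.map (splitLabel (Finset.coe_subset.mpr h)),
    haveI := label_finite S (Y.finite_toSet.sdiff (t := (X : Set S.Var)))
    letI := Fintype.ofFinite (Label S ((Y : Set S.Var) \ (X : Set S.Var)))
    amplify_isSuperOp E.isSuperOp _⟩

/-- The composition `F ∘ E`. -/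
def SuperOp.comp {X : Finset S.Var} (F E : SuperOp S X) : SuperOp S X :=
  ⟨F.map ∘ₗ E.map, comp_isSuperOp F.isSuperOp E.isSuperOp⟩

/-- The identity super-operator. -/
def SuperOp.id (X : Finset S.Var) : SuperOp S X :=
  ⟨LinearMap.id, id_isSuperOp⟩

variable (S) in
/-- A quantum operation `E[X]`. -/
structure Op where
  vars : Finset S.Var
  op : SuperOp S vars

/-- `X₁ ∪ … ∪ Xₙ` for a list `E₁[X₁], …, Eₙ[Xₙ]`. -/
def opVars : List (Op S) → Finset S.Var
  | [] => ∅
  | o :: l => o.vars ∪ opVars l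

theorem vars_subset_opVars : ∀ (l : List (Op S)), ∀ o ∈ l, o.vars ⊆ opVars l
  | [], _, h => by simp at h
  | o' :: l, o, h => by
    rcases List.mem_cons.mp h with rfl | h
    · exact Finset.subset_union_left
    · exact (vars_subset_opVars l o h).trans Finset.subset_union_right

/-- `(Eₙ ⊗ I_{Y∖Xₙ}) ∘ … ∘ (E₁ ⊗ I_{Y∖X₁})` for a list `E₁[X₁], …, Eₙ[Xₙ]` with all `Xᵢ ⊆ Y`. -/
noncomputable def composeIn (Y : Finset S.Var) :
    (l : List (Op S)) → (∀ o ∈ l, o.vars ⊆ Y) → SuperOp S Y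
  | [], _ => SuperOp.id Y
  | o :: l, h =>
    (composeIn Y l fun o' ho' => h o' (List.mem_cons_of_mem o ho')).comp
      (o.op.extend (h o List.mem_cons_self))

/-- The composed operation `E[X]` of `E₁[X₁], …, Eₙ[Xₙ]`, with `X = X₁ ∪ … ∪ Xₙ`. -/
noncomputable def compose (l : List (Op S)) : Op S :=
  ⟨opVars l, composeIn (opVars l) l (vars_subset_opVars l)⟩

variable (S) in
/-- Substitutions of quantum variables: one-to-one maps of the variables into themselves that
preserve types and move only finitely many variables (such a map is a permutation). -/
structure Subst where
  perm : Equiv.Perm S.Var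
  ty_eq : ∀ x, S.ty (perm x) = S.ty x
  finite_moved : {x | perm x ≠ x}.Finite

instance : CoeFun (Subst S) fun _ => S.Var → S.Var := ⟨fun f => f.perm⟩

theorem finite_moved_swap (x y : S.Var) : {z | Equiv.swap x y z ≠ z}.Finite := by
  refine (Set.toFinite {x, y}).subset fun z hz => ?_
  by_contra h
  simp only [Set.mem_insert_iff, Set.mem_singleton_iff, not_or] at h
  exact hz (Equiv.swap_apply_of_ne_of_ne h.1 h.2)

theorem ty_swap {x y : S.Var} (h : S.ty y = S.ty x) (z : S.Var) :
    S.ty (Equiv.swap x y z) = S.ty z := by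
  by_cases h1 : z = x
  · subst h1; simpa using h
  · by_cases h2 : z = y
    · subst h2; simpa using h.symm
    · rw [Equiv.swap_apply_of_ne_of_ne h1 h2]

/-- The substitution `{y/x}`, for variables `x` and `y` of the same type: it maps `x` to `y` and
`y` to `x`. -/
def Subst.single (x y : S.Var) (h : S.ty y = S.ty x) : Subst S :=
  ⟨Equiv.swap x y, ty_swap h, finite_moved_swap x y⟩

/-- The substitution `f_y` with `f_y(y) = y`, `f_y(f⁻¹(y)) = f(y)` and `f_y(z) = f(z)` for all
other `z`. -/
def Subst.fixing (f : Subst S) (y : S.Var) : Subst S :=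
  ⟨f.perm.trans (Equiv.swap y (f y)),
    fun z => (ty_swap (f.ty_eq y) (f z)).trans (f.ty_eq z),
    (f.finite_moved.union (finite_moved_swap y (f y))).subset fun z hz => by
      by_contra h
      simp only [Set.mem_union, Set.mem_ofPred_eq, not_or, not_not] at h
      refine hz ?_
      rw [Equiv.trans_apply, h.1]
      exact h.2⟩

/-- The bijection from the basis of `H_X` onto the basis of `H_{f(X)}` that is induced by a
substitution `f`: the label at `f(x)` is the old label at `x`. -/
def Subst.label (f : Subst S) (X : Finset S.Var) :
    Label S (X : Set S.Var) ≃ Label S ((X.map f.perm.toEmbedding : Finset S.Var) : Set S.Var) where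
  toFun s := ⟨s.1.equivMapDomain f.perm, fun x => by
      have := s.2.1 (f.perm.symm x)
      rwa [← f.ty_eq, Equiv.apply_symm_apply] at this,
    fun x hx => s.2.2 (f.perm.symm x) fun h => hx (by
      simpa [Finset.mem_map_equiv] using h)⟩
  invFun s := ⟨s.1.equivMapDomain f.perm.symm, fun x => by
      have := s.2.1 (f.perm x)
      rwa [f.ty_eq] at this,
    fun x hx => s.2.2 (f.perm x) fun h => hx (by
      simpa [Finset.mem_map_equiv] using h)⟩
  left_inv s := Subtype.ext (by ext x; simp [Finsupp.equivMapDomain_apply])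
  right_inv s := Subtype.ext (by ext x; simp [Finsupp.equivMapDomain_apply])

/-- `(Ef)[f(X)]`, where `Ef = f|_X ∘ E ∘ (f|_X)⁻¹`. -/
noncomputable def Op.subst (f : Subst S) (o : Op S) : Op S :=
  ⟨o.vars.map f.perm.toEmbedding,
    ⟨conj (f.label o.vars) o.op.map, conj_isSuperOp o.op.isSuperOp _⟩⟩

variable (S) in
/-- Actions: `τ`, the quantum operations `E[X]`, the inputs `c?x` and the outputs `c!x`. -/
inductive Act where
  | tau : Act
  | op (o : Op S) : Act
  | inp (c : S.Chan) (x : S.Var) : Act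
  | out (c : S.Chan) (x : S.Var) : Act

/-- The channel name of an action, if it has one. -/
def Act.cn : Act S → Option S.Chan
  | .tau => none
  | .op _ => none
  | .inp c _ => some c
  | .out c _ => some c

/-- The action is an input. -/
def Act.IsInput : Act S → Prop
  | .inp _ _ => True
  | _ => False

variable (S) in
/-- Terms: process constants `A(x₁, …, xₙ)` with distinct `xᵢ`, `nil`, the four prefixes `α.P`, `P + Q`,
`P ‖ Q` and `P \ L`. The terms that are quantum processes are singled out by `RawProc.WF`. -/
inductive RawProc where
  | const (A : S.Const) (x : Fin (S.arity A) ↪ S.Var) : RawProc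
  | nil : RawProc
  | pre (α : Act S) (P : RawProc) : RawProc
  | sum (P Q : RawProc) : RawProc
  | par (P Q : RawProc) : RawProc
  | res (P : RawProc) (L : Set S.Chan) : RawProc

/-- The free quantum variables. -/
def RawProc.fv : RawProc S → Finset S.Var
  | .const _ x => Finset.univ.map x
  | .nil => ∅
  | .pre .tau P => P.fv
  | .pre (.op o) P => P.fv ∪ o.vars
  | .pre (.inp _ x) P => P.fv \ {x}
  | .pre (.out _ x) P => P.fv ∪ {x}
  | .sum P Q => P.fv ∪ Q.fv
  | .par P Q => P.fv ∪ Q.fv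
  | .res P _ => P.fv

/-- The formation rules of quantum processes: a variable that is sent away is not free in the
continuation, and parallel components share no free variable. -/
def RawProc.WF : RawProc S → Prop
  | .const _ _ => True
  | .nil => True
  | .pre .tau P => P.WF
  | .pre (.op _) P => P.WF
  | .pre (.inp _ _) P => P.WF
  | .pre (.out _ x) P => P.WF ∧ x ∉ P.fv
  | .sum P Q => P.WF ∧ Q.WF
  | .par P Q => P.WF ∧ Q.WF ∧ Disjoint P.fv Q.fv
  | .res P _ => P.WF

/-- `IsSubst f P Q` says that `Q` is a result of applying the substitution `f` to `P`. Results
differ only in the choice of the fresh names `y` for bound variables. (In the input clause, the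
free variables of `Pf` are written as the image of those of `P`.) -/
inductive IsSubst : Subst S → RawProc S → RawProc S → Prop
  | const (f : Subst S) (A : S.Const) (x : Fin (S.arity A) ↪ S.Var) :
      IsSubst f (.const A x) (.const A (x.trans f.perm.toEmbedding))
  | nil (f : Subst S) : IsSubst f .nil .nil
  | tau {f : Subst S} {P P' : RawProc S} (h : IsSubst f P P') :
      IsSubst f (.pre .tau P) (.pre .tau P')
  | op {f : Subst S} (o : Op S) {P P' : RawProc S} (h : IsSubst f P P') :
      IsSubst f (.pre (.op o) P) (.pre (.op (o.subst f)) P')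
  | inp {f : Subst S} (c : S.Chan) {x y : S.Var} {P P₁ P₂ : RawProc S} (hty : S.ty y = S.ty x)
      (hy : y ∉ (RawProc.pre (.inp c x) P).fv) (hyf : y ∉ P.fv.map f.perm.toEmbedding)
      (h₁ : IsSubst (Subst.single x y hty) P P₁) (h₂ : IsSubst (f.fixing y) P₁ P₂) :
      IsSubst f (.pre (.inp c x) P) (.pre (.inp c y) P₂)
  | out {f : Subst S} (c : S.Chan) (x : S.Var) {P P' : RawProc S} (h : IsSubst f P P') :
      IsSubst f (.pre (.out c x) P) (.pre (.out c (f x)) P')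
  | sum {f : Subst S} {P P' Q Q' : RawProc S} (h₁ : IsSubst f P P') (h₂ : IsSubst f Q Q') :
      IsSubst f (.sum P Q) (.sum P' Q')
  | par {f : Subst S} {P P' Q Q' : RawProc S} (h₁ : IsSubst f P P') (h₂ : IsSubst f Q Q') :
      IsSubst f (.par P Q) (.par P' Q')
  | res {f : Subst S} {P P' : RawProc S} (L : Set S.Chan) (h : IsSubst f P P') :
      IsSubst f (.res P L) (.res P' L)

variable (S) in
/-- The defining equations `A(params A) := body A` of all process constant schemes `A`. -/
structure DefEqs where
  params : (A : S.Const) → (Fin (S.arity A) ↪ S.Var)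
  body : S.Const → RawProc S
  wf : ∀ A, (body A).WF
  fv_subset : ∀ A, (body A).fv ⊆ Finset.univ.map (params A)

/-- The transitions `⟨P, ρ⟩ -α→ ⟨P', ρ'⟩`. -/
inductive Step (D : DefEqs S) :
    RawProc S → DensityOp S → Act S → RawProc S → DensityOp S → Prop
  | tau (P : RawProc S) (ρ : DensityOp S) : Step D (.pre .tau P) ρ .tau P ρ
  | oper (o : Op S) (P : RawProc S) (ρ : DensityOp S) :
      Step D (.pre (.op o) P) ρ (.op o) P (o.op.apply ρ)
  | input (c : S.Chan) {x y : S.Var} {P P' : RawProc S} (ρ : DensityOp S) (hty : S.ty y = S.ty x)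
      (hy : y ∉ (RawProc.pre (.inp c x) P).fv) (h : IsSubst (Subst.single x y hty) P P') :
      Step D (.pre (.inp c x) P) ρ (.inp c y) P' ρ
  | output (c : S.Chan) (x : S.Var) (P : RawProc S) (ρ : DensityOp S) :
      Step D (.pre (.out c x) P) ρ (.out c x) P ρ
  | choiceL {P P' : RawProc S} (Q : RawProc S) {ρ ρ' : DensityOp S} {α : Act S}
      (h : Step D P ρ α P' ρ') : Step D (.sum P Q) ρ α P' ρ'
  | choiceR {P P' : RawProc S} (Q : RawProc S) {ρ ρ' : DensityOp S} {α : Act S}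
      (h : Step D P ρ α P' ρ') : Step D (.sum Q P) ρ α P' ρ'
  | intl1L {P P' Q : RawProc S} {ρ ρ' : DensityOp S} {c : S.Chan} {x : S.Var} (hx : x ∉ Q.fv)
      (h : Step D P ρ (.inp c x) P' ρ') : Step D (.par P Q) ρ (.inp c x) (.par P' Q) ρ'
  | intl1R {P P' Q : RawProc S} {ρ ρ' : DensityOp S} {c : S.Chan} {x : S.Var} (hx : x ∉ Q.fv)
      (h : Step D P ρ (.inp c x) P' ρ') : Step D (.par Q P) ρ (.inp c x) (.par Q P') ρ'
  | intl2L {P P' : RawProc S} (Q : RawProc S) {ρ ρ' : DensityOp S} {α : Act S}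
      (hα : ¬ α.IsInput) (h : Step D P ρ α P' ρ') : Step D (.par P Q) ρ α (.par P' Q) ρ'
  | intl2R {P P' : RawProc S} (Q : RawProc S) {ρ ρ' : DensityOp S} {α : Act S}
      (hα : ¬ α.IsInput) (h : Step D P ρ α P' ρ') : Step D (.par Q P) ρ α (.par Q P') ρ'
  | commL {P P' Q Q' : RawProc S} {ρ : DensityOp S} {c : S.Chan} {x : S.Var}
      (h₁ : Step D P ρ (.inp c x) P' ρ) (h₂ : Step D Q ρ (.out c x) Q' ρ) :
      Step D (.par P Q) ρ .tau (.par P' Q') ρ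
  | commR {P P' Q Q' : RawProc S} {ρ : DensityOp S} {c : S.Chan} {x : S.Var}
      (h₁ : Step D P ρ (.out c x) P' ρ) (h₂ : Step D Q ρ (.inp c x) Q' ρ) :
      Step D (.par P Q) ρ .tau (.par P' Q') ρ
  | res {P P' : RawProc S} (L : Set S.Chan) {ρ ρ' : DensityOp S} {α : Act S}
      (hα : ∀ c, α.cn = some c → c ∉ L) (h : Step D P ρ α P' ρ') :
      Step D (.res P L) ρ α (.res P' L) ρ'
  | unfold (A : S.Const) {y : Fin (S.arity A) ↪ S.Var} {f : Subst S} {P P' : RawProc S}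
      {ρ ρ' : DensityOp S} {α : Act S} (hf : ∀ i, f (D.params A i) = y i)
      (hP : IsSubst f (D.body A) P) (h : Step D P ρ α P' ρ') :
      Step D (.const A y) ρ α P' ρ'

variable (S) in
/-- The set of quantum processes. -/
abbrev Proc := {P : RawProc S // P.WF}

/-- A strong bisimulation: a symmetric relation between configurations with the transfer
properties for actions that are not inputs, and for inputs of fresh variables. -/
structure IsStrongBisimulation (D : DefEqs S)
    (R : Proc S × DensityOp S → Proc S × DensityOp S → Prop) : Prop where
  symm : ∀ C C', R C C' → R C' C
  transfer : ∀ (P Q : Proc S) (ρ σ : DensityOp S), R (P, ρ) (Q, σ) →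
    ∀ (α : Act S) (P' : Proc S) (ρ' : DensityOp S), ¬ α.IsInput → Step D P.1 ρ α P'.1 ρ' →
      ∃ (Q' : Proc S) (σ' : DensityOp S), Step D Q.1 σ α Q'.1 σ' ∧ R (P', ρ') (Q', σ')
  transfer_input : ∀ (P Q : Proc S) (ρ σ : DensityOp S), R (P, ρ) (Q, σ) →
    ∀ (c : S.Chan) (x : S.Var) (P' : Proc S), Step D P.1 ρ (.inp c x) P'.1 ρ →
      x ∉ P.1.fv ∪ Q.1.fv →
      ∃ Q' : Proc S, Step D Q.1 σ (.inp c x) Q'.1 σ ∧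
        ∀ (y : S.Var) (hty : S.ty y = S.ty x), y ∉ (P'.1.fv ∪ Q'.1.fv) \ {x} →
          ∀ P'' Q'' : Proc S, IsSubst (Subst.single x y hty) P'.1 P''.1 →
            IsSubst (Subst.single x y hty) Q'.1 Q''.1 → R (P'', ρ) (Q'', σ)

/-- Strong bisimilarity of configurations. -/
def BisimilarConf (D : DefEqs S) (C C' : Proc S × DensityOp S) : Prop :=
  ∃ R, IsStrongBisimulation D R ∧ R C C'

/-- Strong bisimilarity `P ∼ Q` of processes. -/
def Bisimilar (D : DefEqs S) (P Q : Proc S) : Prop :=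
  ∀ ρ : DensityOp S, BisimilarConf D (P, ρ) (Q, ρ)

/-- Operation reduction between strings of actions. -/
inductive StringRed : List (Act S) → List (Act S) → Prop
  | operRed (l : List (Op S)) (hl : l ≠ []) : StringRed (l.map .op) [.op (compose l)]
  | struct {t t' : List (Act S)} (t₁ t₂ : List (Act S)) (h : StringRed t t') :
      StringRed (t₁ ++ t ++ t₂) (t₁ ++ t' ++ t₂)

/-- `α₁.⋯.αₘ.P`. -/
def RawProc.pres (t : List (Act S)) (P : RawProc S) : RawProc S := t.foldr .pre P

/-- Operation reduction `P → P'` between processes (it relates well-formed terms only to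
well-formed terms with the same free variables). -/
inductive OpRed : RawProc S → RawProc S → Prop
  | act {t t' : List (Act S)} (h : StringRed t t') (P : RawProc S) : OpRed (P.pres t) (P.pres t')
  | pre (α : Act S) {P P' : RawProc S} (h : OpRed P P') : OpRed (.pre α P) (.pre α P')
  | sumL {P P' : RawProc S} (Q : RawProc S) (h : OpRed P P') : OpRed (.sum P Q) (.sum P' Q)
  | sumR {P P' : RawProc S} (Q : RawProc S) (h : OpRed P P') : OpRed (.sum Q P) (.sum Q P')
  | parL {P P' : RawProc S} (Q : RawProc S) (h : OpRed P P') : OpRed (.par P Q) (.par P' Q)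
  | parR {P P' : RawProc S} (Q : RawProc S) (h : OpRed P P') : OpRed (.par Q P) (.par Q P')
  | res {P P' : RawProc S} (L : Set S.Chan) (h : OpRed P P') : OpRed (.res P L) (.res P' L)
  | refl (P : RawProc S) : OpRed P P
  | trans {P Q R : RawProc S} (h₁ : OpRed P Q) (h₂ : OpRed Q R) : OpRed P R

/-- `P ≃ Q`: there are `P ∼ P₁ → P₂` and `Q ∼ Q₁ → Q₂` with `P₂ ∼ Q₂`. -/
def RedStep (D : DefEqs S) (P Q : Proc S) : Prop :=
  ∃ P₁ P₂ Q₁ Q₂ : Proc S, Bisimilar D P P₁ ∧ OpRed P₁.1 P₂.1 ∧ Bisimilar D Q Q₁ ∧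
    OpRed Q₁.1 Q₂.1 ∧ Bisimilar D P₂ Q₂

/-- Strong reduction-bisimilarity: the transitive closure of `≃`. -/
def RedBisimilar (D : DefEqs S) : Proc S → Proc S → Prop := Relation.TransGen (RedStep D)

/-- The process constant `A(x₁, …, xₙ)`. -/
def Proc.const (A : S.Const) (x : Fin (S.arity A) ↪ S.Var) : Proc S := ⟨.const A x, trivial⟩

/-- The process `E[X].P`. -/
def Proc.op (o : Op S) (P : Proc S) : Proc S := ⟨.pre (.op o) P.1, P.2⟩

/-- The process `E₁[X₁].⋯.Eₙ[Xₙ].P`. -/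
def Proc.ops (l : List (Op S)) (P : Proc S) : Proc S := l.foldr Proc.op P

/-- The process `P + Q`. -/
def Proc.sum (P Q : Proc S) : Proc S := ⟨.sum P.1 Q.1, P.2, Q.2⟩

/-- The process `P ‖ Q`, for processes without common free variables. -/
def Proc.par (P Q : Proc S) (h : Disjoint P.1.fv Q.1.fv) : Proc S := ⟨.par P.1 Q.1, P.2, Q.2, h⟩

/-- The process `P \ L`. -/
def Proc.res (P : Proc S) (L : Set S.Chan) : Proc S := ⟨.res P.1 L, P.2⟩

end Calculus

end QCCS

open QCCS

namespace QCCS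

theorem conj_amplify {I R J I' R' J' : Type*} (Φ : Matrix I I ℂ →ₗ[ℂ] Matrix I I ℂ)
    (e₁ : I × R ≃ J) (e₂ : I' × R' ≃ J') (e : J ≃ J') (eI : I ≃ I') (eR : R → R')
    (h : ∀ a r, e (e₁ (a, r)) = e₂ (eI a, eR r)) :
    conj e (amplify Φ e₁) = amplify (conj eI Φ) e₂ := by
  refine LinearMap.ext fun A => Matrix.ext fun s t => ?_
  obtain ⟨s, rfl⟩ := e.surjective s
  obtain ⟨t, rfl⟩ := e.surjective t
  obtain ⟨⟨a, r⟩, rfl⟩ := e₁.surjective s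
  obtain ⟨⟨b, r'⟩, rfl⟩ := e₁.surjective t
  have hl : conj e (amplify Φ e₁) A (e (e₁ (a, r))) (e (e₁ (b, r'))) =
      Φ (Matrix.of fun c d => A (e (e₁ (c, r))) (e (e₁ (d, r')))) a b := by
    simp [conj, amplify]
  have hr : amplify (conj eI Φ) e₂ A (e₂ (eI a, eR r)) (e₂ (eI b, eR r')) =
      Φ (Matrix.of fun c d => A (e₂ (eI c, eR r)) (e₂ (eI d, eR r'))) a b := by
    simp only [conj, amplify, LinearMap.coe_mk, AddHom.coe_mk, Matrix.of_apply,
      Equiv.symm_apply_apply, LinearMap.comp_apply, LinearEquiv.coe_coe,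
      Matrix.coe_reindexLinearEquiv, Matrix.reindex_apply, Matrix.submatrix_apply, Equiv.symm_symm]
    rfl
  rw [hl, h, h, hr]
  simp only [h]

theorem conj_comp {I J : Type*} (e : I ≃ J) (Φ Ψ : Matrix I I ℂ →ₗ[ℂ] Matrix I I ℂ) :
    conj e (Φ ∘ₗ Ψ) = conj e Φ ∘ₗ conj e Ψ := by
  refine LinearMap.ext fun A => ?_
  simp [conj]

theorem conj_id {I J : Type*} (e : I ≃ J) :
    conj e (LinearMap.id : Matrix I I ℂ →ₗ[ℂ] Matrix I I ℂ) = LinearMap.id := by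
  refine LinearMap.ext fun A => ?_
  simp [conj]

theorem conj_refl {I : Type*} (Φ : Matrix I I ℂ →ₗ[ℂ] Matrix I I ℂ) :
    conj (Equiv.refl I) Φ = Φ := rfl

variable {S : Signature.{u}}

theorem Label.ext {Y : Set S.Var} {s t : Label S Y} (h : ∀ x ∈ Y, s.1 x = t.1 x) : s = t := by
  refine Subtype.ext (Finsupp.ext fun x => ?_)
  by_cases hx : x ∈ Y
  · exact h x hx
  · rw [s.2.2 x hx, t.2.2 x hx]

namespace Subst

/-- The identity substitution. -/
def one : Subst S := ⟨Equiv.refl _, fun _ => rfl, by simp⟩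

/-- The composition of substitutions: first `f`, then `g`. -/
def comp (g f : Subst S) : Subst S :=
  ⟨f.perm.trans g.perm, fun x => (g.ty_eq _).trans (f.ty_eq x),
    (f.finite_moved.union g.finite_moved).subset fun x hx => by
      by_contra h
      simp only [Set.mem_union, Set.mem_ofPred_eq, not_or, not_not] at h
      exact hx (by rw [Equiv.trans_apply, h.1, h.2])⟩

/-- The inverse substitution. -/
def inv (f : Subst S) : Subst S :=
  ⟨f.perm.symm, fun x => by rw [← f.ty_eq, Equiv.apply_symm_apply],
    f.finite_moved.subset fun x hx h => hx (by rw [Equiv.symm_apply_eq]; exact h.symm)⟩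

@[simp] theorem one_apply (x : S.Var) : (one : Subst S) x = x := rfl

@[simp] theorem comp_apply (g f : Subst S) (x : S.Var) : g.comp f x = g (f x) := rfl

@[simp] theorem inv_apply (f : Subst S) (x : S.Var) : f.inv (f x) = x := f.perm.symm_apply_apply x

@[simp] theorem apply_inv (f : Subst S) (x : S.Var) : f (f.inv x) = x := f.perm.apply_symm_apply x

theorem inj (f : Subst S) {x y : S.Var} (h : f x = f y) : x = y := f.perm.injective h

theorem single_left (x y : S.Var) (h : S.ty y = S.ty x) : single x y h x = y :=
  Equiv.swap_apply_left x y

theorem single_of_ne {x y z : S.Var} (h : S.ty y = S.ty x) (hx : z ≠ x) (hy : z ≠ y) :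
    single x y h z = z :=
  Equiv.swap_apply_of_ne_of_ne hx hy

theorem fixing_self (f : Subst S) (y : S.Var) : f.fixing y y = y :=
  Equiv.swap_apply_right y (f y)

theorem fixing_of_ne (f : Subst S) {y z : S.Var} (h : z ≠ y) (hf : f z ≠ y) :
    f.fixing y z = f z :=
  Equiv.swap_apply_of_ne_of_ne hf fun h' => h (f.inj h')

theorem label_apply (f : Subst S) (X : Finset S.Var) (s : Label S (X : Set S.Var)) (x : S.Var) :
    (f.label X s).1 (f x) = s.1 x :=
  congrArg s.1 (f.perm.symm_apply_apply x)

end Subst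

/-- The type of the super-operator depends on the variable set, so equality of operations cannot be
checked componentwise. Once the variable sets are identified, `he` forces `e` to be `f.label`. -/
theorem Op.eq_subst (f : Subst S) {o o' : Op S} (hv : o'.vars = o.vars.map f.perm.toEmbedding)
    (e : Label S (o.vars : Set S.Var) ≃ Label S (o'.vars : Set S.Var))
    (he : ∀ s, ∀ x ∈ o.vars, (e s).1 (f x) = s.1 x) (hm : o'.op.map = conj e o.op.map) :
    o' = o.subst f := by
  obtain ⟨Z, F, hF⟩ := o'
  dsimp only at hv e he hm
  subst hv
  have : e = f.label o.vars := by
    refine Equiv.ext fun s => Label.ext fun y hy => ?_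
    obtain ⟨x, hx, rfl⟩ := Finset.mem_map.mp (Finset.mem_coe.mp hy)
    exact (he s x hx).trans (f.label_apply _ s x).symm
  have hF' : F = conj (f.label o.vars) o.op.map := by rw [hm, this]
  subst hF'
  rfl

theorem Op.subst_congr {f g : Subst S} {o : Op S} (h : ∀ x ∈ o.vars, f x = g x) :
    o.subst f = o.subst g := by
  refine Op.eq_subst g ?_ (f.label o.vars) (fun s x hx => ?_) rfl
  · refine Finset.ext fun y => ?_
    simp only [Op.subst, Finset.mem_map, Equiv.coe_toEmbedding]
    exact exists_congr fun x => and_congr_right fun hx => by rw [h x hx]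
  · rw [← h x hx]
    exact f.label_apply _ s x

theorem Op.subst_one (o : Op S) : o.subst Subst.one = o :=
  (Op.eq_subst Subst.one (by simp [Subst.one]) (Equiv.refl _) (fun _ _ _ => rfl)
    (conj_refl _).symm).symm

theorem Op.subst_subst (f g : Subst S) (o : Op S) : (o.subst f).subst g = o.subst (g.comp f) := by
  refine Op.eq_subst _ ?_ ((f.label o.vars).trans (g.label _)) (fun s x _ => ?_) rfl
  · simp only [Op.subst, Finset.map_map]
    rfl
  · exact (g.label_apply _ _ _).trans (f.label_apply _ _ _)

theorem opVars_map_subst (f : Subst S) (l : List (Op S)) :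
    opVars (l.map (Op.subst f)) = (opVars l).map f.perm.toEmbedding := by
  induction l with
  | nil => rfl
  | cons o l ih => simp [opVars, ih, Op.subst, Finset.map_union]

theorem conj_extend (f : Subst S) {X Y : Finset S.Var} (h : X ⊆ Y) (E : SuperOp S X)
    (h' : X.map f.perm.toEmbedding ⊆ Y.map f.perm.toEmbedding) :
    conj (f.label Y) (E.extend h).map =
      (SuperOp.extend h' (Op.subst f ⟨X, E⟩).op).map := by
  refine conj_amplify E.map _ _ _ (f.label X) (fun s => ⟨s.1.equivMapDomain f.perm, fun x => ?_,
    fun x hx => s.2.2 (f.perm.symm x) fun h => hx ?_⟩) fun a r => Label.ext fun x _ => ?_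
  · have := s.2.1 (f.perm.symm x)
    rwa [← f.ty_eq, Equiv.apply_symm_apply] at this
  · simpa [Finset.mem_map_equiv] using h
  · obtain ⟨x, rfl⟩ := f.perm.surjective x
    refine (f.label_apply _ _ _).trans ?_
    change a.1 x + r.1 x = (f.label X a).1 (f x) + r.1.equivMapDomain f.perm (f.perm x)
    rw [f.label_apply, Finsupp.equivMapDomain_apply, Equiv.symm_apply_apply]

theorem conj_composeIn (f : Subst S) (Y : Finset S.Var) :
    ∀ (l : List (Op S)) (h : ∀ o ∈ l, o.vars ⊆ Y)
      (h' : ∀ o ∈ l.map (Op.subst f), o.vars ⊆ Y.map f.perm.toEmbedding),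
      conj (f.label Y) (composeIn Y l h).map =
        (composeIn (Y.map f.perm.toEmbedding) (l.map (Op.subst f)) h').map
  | [], _, _ => conj_id _
  | o :: l, h, h' => by
    refine (conj_comp _ _ _).trans ?_
    rw [conj_composeIn f Y l _ fun o' ho' => h' o' (List.mem_cons_of_mem _ ho'),
      conj_extend f _ _ (Finset.map_subset_map.mpr (h o List.mem_cons_self))]
    rfl

theorem compose_map_subst (f : Subst S) (l : List (Op S)) :
    compose (l.map (Op.subst f)) = (compose l).subst f := by
  -- The variable set is generalized to an arbitrary `Z` equal to it, so that `opVars_map_subst` can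
  -- be used without rewriting inside dependent types.
  have key : ∀ Z (hZ : opVars (l.map (Op.subst f)) = Z)
      (h' : ∀ o ∈ l.map (Op.subst f), o.vars ⊆ Z),
      compose (l.map (Op.subst f)) = ⟨Z, composeIn Z (l.map (Op.subst f)) h'⟩ := by
    rintro _ rfl _
    rfl
  have h' := vars_subset_opVars (l.map (Op.subst f))
  rw [opVars_map_subst] at h'
  rw [key _ (opVars_map_subst f l) h']
  exact Op.eq_subst f rfl (f.label _) (fun s x _ => f.label_apply _ s x)
    (conj_composeIn f _ l _ h').symm

/-! ### Renaming of actions and of processes up to `α`-equivalence -/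

theorem exists_fresh (x : S.Var) (F : Finset S.Var) : ∃ y, S.ty y = S.ty x ∧ y ∉ F :=
  (S.infinite_type x).exists_notMem_finset F

namespace Act

/-- The renaming of the variables of an action. -/
noncomputable def subst (f : Subst S) : Act S → Act S
  | .tau => .tau
  | .op o => .op (o.subst f)
  | .inp c x => .inp c (f x)
  | .out c x => .out c (f x)

/-- The variables of an action. -/
def vars : Act S → Finset S.Var
  | .tau => ∅
  | .op o => o.vars
  | .inp _ x => {x}
  | .out _ x => {x}

theorem subst_congr {f g : Subst S} {α : Act S} (h : ∀ x ∈ α.vars, f x = g x) :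
    α.subst f = α.subst g := by
  cases α with
  | tau => rfl
  | op o => exact congrArg Act.op (Op.subst_congr h)
  | inp c x => exact congrArg (Act.inp c) (h x (Finset.mem_singleton_self x))
  | out c x => exact congrArg (Act.out c) (h x (Finset.mem_singleton_self x))

@[simp] theorem subst_one (α : Act S) : α.subst Subst.one = α := by
  cases α with
  | op o => exact congrArg Act.op o.subst_one
  | _ => rfl

theorem subst_subst (f g : Subst S) (α : Act S) : (α.subst f).subst g = α.subst (g.comp f) := by
  cases α with
  | op o => exact congrArg Act.op (o.subst_subst f g)
  | _ => rfl

@[simp] theorem subst_inv_subst (f : Subst S) (α : Act S) : (α.subst f).subst f.inv = α := by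
  rw [subst_subst, subst_congr (g := Subst.one) (by simp), subst_one]

@[simp] theorem subst_subst_inv (f : Subst S) (α : Act S) : (α.subst f.inv).subst f = α := by
  rw [subst_subst, subst_congr (g := Subst.one) (by simp), subst_one]

theorem mem_vars_subst (f : Subst S) (α : Act S) (z : S.Var) :
    f z ∈ (α.subst f).vars ↔ z ∈ α.vars := by
  cases α <;> simp [subst, vars, Op.subst]

@[simp] theorem isInput_subst (f : Subst S) (α : Act S) : (α.subst f).IsInput ↔ α.IsInput := by
  cases α <;> rfl

@[simp] theorem cn_subst (f : Subst S) (α : Act S) : (α.subst f).cn = α.cn := by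
  cases α <;> rfl

end Act

theorem RawProc.fv_pre {α : Act S} (hα : ¬ α.IsInput) (P : RawProc S) :
    (RawProc.pre α P).fv = P.fv ∪ α.vars := by
  cases α with
  | inp c x => exact absurd trivial hα
  | tau => exact (Finset.union_empty _).symm
  | _ => rfl

/-- `Ren f P Q` says that `Q` is `α`-equivalent to the result of renaming the free variables of `P`
by `f`. -/
inductive Ren : Subst S → RawProc S → RawProc S → Prop
  | const {f : Subst S} (A : S.Const) {x y : Fin (S.arity A) ↪ S.Var} (h : ∀ i, y i = f (x i)) :
      Ren f (.const A x) (.const A y)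
  | nil (f : Subst S) : Ren f .nil .nil
  | pre {f : Subst S} {α β : Act S} {P P' : RawProc S} (hα : ¬ α.IsInput) (hβ : β = α.subst f)
      (h : Ren f P P') : Ren f (.pre α P) (.pre β P')
  | inp {f g : Subst S} (c : S.Chan) {x y : S.Var} {P P' : RawProc S}
      (hg : ∀ z ∈ P.fv, z ≠ x → g z = f z) (hx : g x = y) (h : Ren g P P') :
      Ren f (.pre (.inp c x) P) (.pre (.inp c y) P')
  | sum {f : Subst S} {P P' Q Q' : RawProc S} (h₁ : Ren f P P') (h₂ : Ren f Q Q') :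
      Ren f (.sum P Q) (.sum P' Q')
  | par {f : Subst S} {P P' Q Q' : RawProc S} (h₁ : Ren f P P') (h₂ : Ren f Q Q') :
      Ren f (.par P Q) (.par P' Q')
  | res {f : Subst S} {P P' : RawProc S} (L : Set S.Chan) (h : Ren f P P') :
      Ren f (.res P L) (.res P' L)

namespace Ren

variable {f g : Subst S} {P Q R : RawProc S}

theorem congr (h : Ren f P Q) (hfg : ∀ x ∈ P.fv, g x = f x) : Ren g P Q := by
  induction h generalizing g with
  | const A h =>
    exact .const A fun i => (h i).trans (hfg _ (by simp [RawProc.fv])).symm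
  | nil f => exact .nil g
  | pre hα hβ h ih =>
    rw [RawProc.fv_pre hα] at hfg
    refine .pre hα (hβ.trans ?_) (ih fun x hx => hfg x (Finset.mem_union_left _ hx))
    exact Act.subst_congr fun x hx => (hfg x (Finset.mem_union_right _ hx)).symm
  | inp c hg hx h =>
    exact .inp c (fun z hz hzx => (hg z hz hzx).trans
      (hfg z (by simpa [RawProc.fv] using ⟨hz, hzx⟩)).symm) hx h
  | sum h₁ h₂ ih₁ ih₂ =>
    exact .sum (ih₁ fun x hx => hfg x (Finset.mem_union_left _ hx))
      (ih₂ fun x hx => hfg x (Finset.mem_union_right _ hx))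
  | par h₁ h₂ ih₁ ih₂ =>
    exact .par (ih₁ fun x hx => hfg x (Finset.mem_union_left _ hx))
      (ih₂ fun x hx => hfg x (Finset.mem_union_right _ hx))
  | res L h ih => exact .res L (ih hfg)

theorem mem_fv (h : Ren f P Q) (z : S.Var) : f z ∈ Q.fv ↔ z ∈ P.fv := by
  induction h generalizing z with
  | const A h =>
    simp only [RawProc.fv, Finset.mem_map, Finset.mem_univ, true_and, h]
    exact exists_congr fun i => ⟨fun h => Subst.inj _ h, fun h => by rw [h]⟩
  | nil f => simp [RawProc.fv]
  | pre hα hβ h ih =>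
    subst hβ
    rw [RawProc.fv_pre hα, RawProc.fv_pre (by simpa using hα)]
    simp [ih, Act.mem_vars_subst]
  | @inp f g c x y P P' hg hx h ih =>
    subst hx
    simp only [RawProc.fv, Finset.mem_sdiff, Finset.mem_singleton]
    constructor
    · rintro ⟨h1, h2⟩
      -- As `g` permutes all variables, `f z` is the image under `g` of some variable. That variable
      -- is free in the body and differs from `x`, so `f` and `g` agree there and it must be `z`.
      rw [← g.apply_inv (f z)] at h1 h2
      rw [ih] at h1
      have hne : g.inv (f z) ≠ x := fun h' => h2 (by rw [h'])
      have := hg _ h1 hne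
      rw [Subst.apply_inv] at this
      rw [f.inj this]
      exact ⟨h1, hne⟩
    · rintro ⟨h1, h2⟩
      rw [← hg z h1 h2, ih]
      exact ⟨h1, fun h' => h2 (g.inj h')⟩
  | sum h₁ h₂ ih₁ ih₂ => simp [RawProc.fv, ih₁, ih₂]
  | par h₁ h₂ ih₁ ih₂ => simp [RawProc.fv, ih₁, ih₂]
  | res L h ih => exact ih z

theorem refl (P : RawProc S) : Ren Subst.one P P := by
  induction P with
  | const A x => exact .const A fun _ => rfl
  | nil => exact .nil _
  | pre α P ih =>
    by_cases hα : α.IsInput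
    · cases α with
      | inp c x => exact .inp c (fun _ _ _ => rfl) rfl ih
      | _ => exact hα.elim
    · exact .pre hα α.subst_one.symm ih
  | sum P Q ih₁ ih₂ => exact .sum ih₁ ih₂
  | par P Q ih₁ ih₂ => exact .par ih₁ ih₂
  | res P L ih => exact .res L ih

theorem refl_of_fixed (h : ∀ x ∈ P.fv, f x = x) : Ren f P P := (refl P).congr h

theorem trans (h : Ren f P Q) (h' : Ren g Q R) : Ren (g.comp f) P R := by
  induction h generalizing g R with
  | const A h =>
    cases h' with
    | const _ h' => exact .const A fun i => by rw [h', h]; rfl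
  | nil f =>
    cases h'
    exact .nil _
  | @pre f α β P P' hα hβ h ih =>
    cases h' with
    | pre hα' hβ' h' => exact .pre hα (by rw [hβ', hβ, Act.subst_subst]) (ih h')
    | inp c hg hx h' => exact absurd ((Act.isInput_subst f α).mp (hβ ▸ trivial)) hα
  | inp c hg hx h ih =>
    subst hx
    cases h' with
    | pre hα _ _ => exact absurd trivial hα
    | inp _ hg' hx' h' =>
      refine .inp c (fun z hz hzx => ?_) hx' (ih h')
      rw [Subst.comp_apply, hg' _ ((h.mem_fv z).mpr hz) fun h => hzx (Subst.inj _ h),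
        hg z hz hzx, Subst.comp_apply]
  | sum h₁ h₂ ih₁ ih₂ =>
    cases h' with
    | sum h₁' h₂' => exact .sum (ih₁ h₁') (ih₂ h₂')
  | par h₁ h₂ ih₁ ih₂ =>
    cases h' with
    | par h₁' h₂' => exact .par (ih₁ h₁') (ih₂ h₂')
  | res L h ih =>
    cases h' with
    | res _ h' => exact .res L (ih h')

theorem symm (h : Ren f P Q) : Ren f.inv Q P := by
  induction h with
  | const A h => exact .const A fun i => by rw [h, Subst.inv_apply]
  | nil f => exact .nil _
  | pre hα hβ h ih =>
    subst hβ
    exact .pre (by simpa using hα) (by simp) ih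
  | @inp f g c x y P P' hg hx h ih =>
    subst hx
    refine .inp c (fun z hz hzx => ?_) (g.inv_apply x) ih
    rw [← g.apply_inv z, h.mem_fv] at hz
    have hne : g.inv z ≠ x := fun h' => hzx (by rw [← h', g.apply_inv])
    have := hg _ hz hne
    rw [g.apply_inv] at this
    calc g.inv z = f.inv (f (g.inv z)) := (f.inv_apply _).symm
      _ = f.inv z := by rw [← this]
  | sum h₁ h₂ ih₁ ih₂ => exact .sum ih₁ ih₂
  | par h₁ h₂ ih₁ ih₂ => exact .par ih₁ ih₂
  | res L h ih => exact .res L ih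

theorem mem_fv_iff (h : Ren f P Q) (z : S.Var) : z ∈ Q.fv ↔ f.inv z ∈ P.fv := by
  rw [← h.mem_fv, f.apply_inv]

theorem disjoint_fv {P' Q' : RawProc S} (h : Ren f P Q) (h' : Ren f P' Q')
    (hd : Disjoint P.fv P'.fv) : Disjoint Q.fv Q'.fv := by
  rw [Finset.disjoint_left] at hd ⊢
  intro z hz hz'
  exact hd ((h.mem_fv_iff z).mp hz) ((h'.mem_fv_iff z).mp hz')

theorem wf (h : Ren f P Q) (hP : P.WF) : Q.WF := by
  induction h with
  | const A h => trivial
  | nil f => trivial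
  | @pre f α β P P' hα hβ h ih =>
    subst hβ
    cases α with
    | out c x => exact ⟨ih hP.1, by rw [h.mem_fv]; exact hP.2⟩
    | _ => exact ih hP
  | inp c hg hx h ih => exact ih hP
  | sum h₁ h₂ ih₁ ih₂ => exact ⟨ih₁ hP.1, ih₂ hP.2⟩
  | par h₁ h₂ ih₁ ih₂ => exact ⟨ih₁ hP.1, ih₂ hP.2.1, h₁.disjoint_fv h₂ hP.2.2⟩
  | res L h ih => exact ih hP

end Ren

/-- At an input, the swap of `x` and `y` followed by `f.fixing y` serves as the renaming of the
body: it sends `x` to `y`, and the two freshness conditions on `y` make it agree with `f` on the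
other free variables. -/
theorem IsSubst.ren {f : Subst S} {P Q : RawProc S} (h : IsSubst f P Q) : Ren f P Q := by
  induction h with
  | const f A x => exact .const A fun _ => rfl
  | nil f => exact .nil f
  | tau h ih => exact .pre id rfl ih
  | op o h ih => exact .pre id rfl ih
  | @inp f c x y P P₁ P₂ hty hy hyf h₁ h₂ ih₁ ih₂ =>
    refine .inp c (fun z hz hzx => ?_) ?_ (ih₁.trans ih₂)
    · have hzy : z ≠ y := by
        rintro rfl
        exact hy (by simpa [RawProc.fv] using ⟨hz, hzx⟩)
      rw [Subst.comp_apply, Subst.single_of_ne hty hzx hzy, Subst.fixing_of_ne f hzy]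
      rintro rfl
      exact hyf (Finset.mem_map_of_mem _ hz)
    · rw [Subst.comp_apply, Subst.single_left, Subst.fixing_self]
  | out c x h ih => exact .pre id rfl ih
  | sum h₁ h₂ ih₁ ih₂ => exact .sum ih₁ ih₂
  | par h₁ h₂ ih₁ ih₂ => exact .par ih₁ ih₂
  | res L h ih => exact .res L ih

/-- The number of constructors of a term. -/
def RawProc.size : RawProc S → ℕ
  | .const _ _ => 0
  | .nil => 0
  | .pre _ P => P.size + 1
  | .sum P Q => P.size + Q.size + 1
  | .par P Q => P.size + Q.size + 1
  | .res P _ => P.size + 1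

theorem Ren.size_eq {f : Subst S} {P Q : RawProc S} (h : Ren f P Q) : Q.size = P.size := by
  induction h <;> simp_all [RawProc.size]

/-- The induction is on size because the input clause substitutes a second time, into `P₁`, which is
not a subterm but has the size of one. -/
theorem exists_isSubst (f : Subst S) (P : RawProc S) : ∃ Q, IsSubst f P Q := by
  induction hn : P.size using Nat.strong_induction_on generalizing f P with
  | _ n ih =>
    subst hn
    cases P with
    | const A x => exact ⟨_, .const f A x⟩
    | nil => exact ⟨_, .nil f⟩
    | pre α P =>
      have ih' : ∀ f : Subst S, ∃ Q, IsSubst f P Q := fun f =>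
        ih _ (Nat.lt_succ_self P.size) f P rfl
      cases α with
      | tau => exact (ih' f).imp' _ fun _ h => .tau h
      | op o => exact (ih' f).imp' _ fun _ h => .op o h
      | inp c x =>
        obtain ⟨y, hty, hy⟩ :=
          exists_fresh x ((RawProc.pre (.inp c x) P).fv ∪ P.fv.map f.perm.toEmbedding)
        rw [Finset.mem_union, not_or] at hy
        obtain ⟨P₁, h₁⟩ := ih' (Subst.single x y hty)
        obtain ⟨P₂, h₂⟩ := ih P₁.size
          (by rw [h₁.ren.size_eq]; exact Nat.lt_succ_self _) (f.fixing y) P₁ rfl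
        exact ⟨_, .inp c hty hy.1 hy.2 h₁ h₂⟩
      | out c x => exact (ih' f).imp' _ fun _ h => .out c x h
    | sum P Q =>
      obtain ⟨P', h₁⟩ := ih P.size (by simp only [RawProc.size]; omega) f P rfl
      obtain ⟨Q', h₂⟩ := ih Q.size (by simp only [RawProc.size]; omega) f Q rfl
      exact ⟨_, .sum h₁ h₂⟩
    | par P Q =>
      obtain ⟨P', h₁⟩ := ih P.size (by simp only [RawProc.size]; omega) f P rfl
      obtain ⟨Q', h₂⟩ := ih Q.size (by simp only [RawProc.size]; omega) f Q rfl
      exact ⟨_, .par h₁ h₂⟩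
    | res P L => exact (ih _ (Nat.lt_succ_self P.size) f P rfl).imp' _ fun _ h => .res L h

/-! ### Transitions: irrelevance of states, free variables, invariance under renaming -/

variable {D : DefEqs S}

/-- The effect of an action on the state of the environment. -/
noncomputable def Act.act : Act S → DensityOp S → DensityOp S
  | .op o, ρ => o.op.apply ρ
  | _, ρ => ρ

/-- No rule has a condition on the state. In a communication both premises keep the common state,
because inputs and outputs act on states as the identity. -/
theorem Step.change_state {P P' : RawProc S} {ρ ρ' : DensityOp S} {α : Act S}
    (h : Step D P ρ α P' ρ') (σ : DensityOp S) : Step D P σ α P' (α.act σ) := by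
  induction h generalizing σ with
  | tau P ρ => exact .tau P σ
  | oper o P ρ => exact .oper o P σ
  | input c ρ hty hy h => exact .input c σ hty hy h
  | output c x P ρ => exact .output c x P σ
  | choiceL Q h ih => exact .choiceL Q (ih σ)
  | choiceR Q h ih => exact .choiceR Q (ih σ)
  | intl1L hx h ih => exact .intl1L hx (ih σ)
  | intl1R hx h ih => exact .intl1R hx (ih σ)
  | intl2L Q hα h ih => exact .intl2L Q hα (ih σ)
  | intl2R Q hα h ih => exact .intl2R Q hα (ih σ)
  | commL h₁ h₂ ih₁ ih₂ => exact .commL (ih₁ σ) (ih₂ σ)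
  | commR h₁ h₂ ih₁ ih₂ => exact .commR (ih₁ σ) (ih₂ σ)
  | res L hα h ih => exact .res L hα (ih σ)
  | unfold A hf hP h ih => exact .unfold A hf hP (ih σ)

/-- The input variable of an action. -/
def Act.inputs : Act S → Finset S.Var
  | .inp _ x => {x}
  | _ => ∅

theorem Act.inputs_eq_empty {α : Act S} (hα : ¬ α.IsInput) : α.inputs = ∅ := by
  cases α with
  | inp c x => exact absurd trivial hα
  | _ => rfl

/-- The three claims need one induction: parallel residuals are well-formed only if the free
variables stay disjoint. In a communication the receiver gains the variable that is sent, which is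
harmless because the sender has lost it. -/
theorem Step.wf_and_fv {P P' : RawProc S} {ρ ρ' : DensityOp S} {α : Act S}
    (h : Step D P ρ α P' ρ') (hP : P.WF) :
    P'.WF ∧ P'.fv ⊆ P.fv ∪ α.inputs ∧ ∀ c x, α = .out c x → x ∈ P.fv ∧ x ∉ P'.fv := by
  induction h with
  | tau P ρ => exact ⟨hP, by simp [RawProc.fv], by simp⟩
  | oper o P ρ => exact ⟨hP, fun z hz => by simp [RawProc.fv, hz], by simp⟩
  | @input c x y P P' ρ hty hy h =>
    refine ⟨h.ren.wf hP, fun z hz => ?_, by simp⟩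
    by_contra hzn
    simp only [Finset.mem_union, Act.inputs, Finset.mem_singleton, RawProc.fv, Finset.mem_sdiff,
      not_or, not_and, not_not] at hzn hy
    rw [h.ren.mem_fv_iff] at hz
    by_cases hzx : z = x
    · subst hzx
      have h1 : (Subst.single z y hty).inv z = y := Equiv.swap_apply_left z y
      rw [h1] at hz
      exact hzn.2 (hy hz).symm
    · have h1 : (Subst.single x y hty).inv z = z := by
        conv_lhs => rw [← Subst.single_of_ne hty hzx hzn.2]
        exact Subst.inv_apply _ _
      rw [h1] at hz
      exact hzx (hzn.1 hz)
  | output c x P ρ =>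
    refine ⟨hP.1, fun z hz => by simp [RawProc.fv, hz], fun c' x' h => ?_⟩
    injection h with _ h
    subst h
    exact ⟨by simp [RawProc.fv], hP.2⟩
  | choiceL Q h ih =>
    obtain ⟨h1, h2, h3⟩ := ih hP.1
    exact ⟨h1, h2.trans (by simp only [RawProc.fv]; grind),
      fun c x h => ⟨Finset.mem_union_left _ (h3 c x h).1, (h3 c x h).2⟩⟩
  | choiceR Q h ih =>
    obtain ⟨h1, h2, h3⟩ := ih hP.2
    exact ⟨h1, h2.trans (by simp only [RawProc.fv]; grind),
      fun c x h => ⟨Finset.mem_union_right _ (h3 c x h).1, (h3 c x h).2⟩⟩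
  | intl1L hx h ih =>
    obtain ⟨h1, h2, h3⟩ := ih hP.1
    have hd := hP.2.2
    simp only [Act.inputs, RawProc.fv, RawProc.WF, Finset.disjoint_left] at *
    exact ⟨⟨h1, hP.2.1, by grind⟩, by grind, by simp⟩
  | intl1R hx h ih =>
    obtain ⟨h1, h2, h3⟩ := ih hP.2.1
    have hd := hP.2.2
    simp only [Act.inputs, RawProc.fv, RawProc.WF, Finset.disjoint_left] at *
    exact ⟨⟨hP.1, h1, by grind⟩, by grind, by simp⟩
  | intl2L Q hα h ih =>
    obtain ⟨h1, h2, h3⟩ := ih hP.1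
    have hd := hP.2.2
    rw [Act.inputs_eq_empty hα, Finset.union_empty] at h2 ⊢
    exact ⟨⟨h1, hP.2.1, hd.mono_left h2⟩, Finset.union_subset_union_left h2, fun c x h =>
      ⟨Finset.mem_union_left _ (h3 c x h).1, by
        simp only [RawProc.fv, Finset.mem_union, not_or]
        exact ⟨(h3 c x h).2, Finset.disjoint_left.mp hd (h3 c x h).1⟩⟩⟩
  | intl2R Q hα h ih =>
    obtain ⟨h1, h2, h3⟩ := ih hP.2.1
    have hd := hP.2.2
    rw [Act.inputs_eq_empty hα, Finset.union_empty] at h2 ⊢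
    exact ⟨⟨hP.1, h1, hd.mono_right h2⟩, Finset.union_subset_union_right h2, fun c x h =>
      ⟨Finset.mem_union_right _ (h3 c x h).1, by
        simp only [RawProc.fv, Finset.mem_union, not_or]
        exact ⟨Finset.disjoint_right.mp hd (h3 c x h).1, (h3 c x h).2⟩⟩⟩
  | commL h₁ h₂ ih₁ ih₂ =>
    obtain ⟨h1, h2, -⟩ := ih₁ hP.1
    obtain ⟨k1, k2, k3⟩ := ih₂ hP.2.1
    have k4 := k3 _ _ rfl
    have hd := hP.2.2
    simp only [Act.inputs, RawProc.fv, RawProc.WF, Finset.disjoint_left] at *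
    exact ⟨⟨h1, k1, by grind⟩, by grind, by simp⟩
  | commR h₁ h₂ ih₁ ih₂ =>
    obtain ⟨h1, h2, h3⟩ := ih₁ hP.1
    obtain ⟨k1, k2, -⟩ := ih₂ hP.2.1
    have h4 := h3 _ _ rfl
    have hd := hP.2.2
    simp only [Act.inputs, RawProc.fv, RawProc.WF, Finset.disjoint_left] at *
    exact ⟨⟨h1, k1, by grind⟩, by grind, by simp⟩
  | res L hα h ih => exact ih hP
  | unfold A hf hP' h ih =>
    rename_i y f P P' ρ ρ' α
    obtain ⟨h1, h2, h3⟩ := ih (hP'.ren.wf (D.wf A))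
    have hsub : P.fv ⊆ (RawProc.const A y).fv := fun z hz => by
      rw [hP'.ren.mem_fv_iff] at hz
      obtain ⟨i, -, hi⟩ := Finset.mem_map.mp (D.fv_subset A hz)
      refine Finset.mem_map.mpr ⟨i, Finset.mem_univ i, ?_⟩
      rw [← hf, hi, f.apply_inv]
    exact ⟨h1, h2.trans (Finset.union_subset_union_left hsub),
      fun c x h => ⟨hsub (h3 c x h).1, (h3 c x h).2⟩⟩

/-- The transitions of processes, without the states of the environment. -/
def Trans (D : DefEqs S) (P : RawProc S) (α : Act S) (P' : RawProc S) : Prop :=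
  ∃ ρ ρ', Step D P ρ α P' ρ'

theorem Trans.step {P P' : RawProc S} {α : Act S} (h : Trans D P α P') (σ : DensityOp S) :
    Step D P σ α P' (α.act σ) :=
  h.choose_spec.choose_spec.change_state σ

theorem Step.trans {P P' : RawProc S} {ρ ρ' : DensityOp S} {α : Act S}
    (h : Step D P ρ α P' ρ') : Trans D P α P' :=
  ⟨ρ, ρ', h⟩

theorem Trans.wf {P P' : RawProc S} {α : Act S} (h : Trans D P α P') (hP : P.WF) : P'.WF :=
  (h.choose_spec.choose_spec.wf_and_fv hP).1

theorem Ren.exists_step {P P' Q : RawProc S} {ρ ρ' : DensityOp S} {α : Act S} {f : Subst S}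
    (hf : Ren f P Q) (h : Step D P ρ α P' ρ') :
    ∃ Q', Step D Q ρ (α.subst f) Q' ((α.subst f).act ρ) ∧ Ren f P' Q' := by
  induction h generalizing f Q with
  | tau P ρ =>
    cases hf with
    | pre hα hβ h => subst hβ; exact ⟨_, .tau _ _, h⟩
  | oper o P ρ =>
    cases hf with
    | pre hα hβ h => subst hβ; exact ⟨_, .oper _ _ _, h⟩
  | output c x P ρ =>
    cases hf with
    | pre hα hβ h => subst hβ; exact ⟨_, .output _ _ _ _, h⟩
  | @input c x y P P' ρ hty hy h =>
    have hQ := hf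
    cases hf with
    | pre hα hβ h => exact absurd trivial hα
    | @inp _ g _ _ x' _ Q hg hx hr =>
      -- The renamed process receives `f y`. It remains to see that undoing the swap of `x` and `y`,
      -- renaming by `g` and swapping `x'` with `f y` amounts to `f` on the free variables of the
      -- residual.
      have hty' : S.ty (f y) = S.ty x' := by rw [← hx, f.ty_eq, g.ty_eq, hty]
      obtain ⟨Q', hQ'⟩ := exists_isSubst (Subst.single x' (f y) hty') Q
      refine ⟨Q', .input c ρ hty' (by rwa [hQ.mem_fv]) hQ',
        ((h.ren.symm.trans hr).trans hQ'.ren).congr fun z hz => ?_⟩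
      rw [h.ren.mem_fv_iff] at hz
      obtain ⟨w, rfl⟩ : ∃ w, z = Subst.single x y hty w :=
        ⟨_, (Subst.apply_inv _ z).symm⟩
      simp only [Subst.inv_apply, Subst.comp_apply] at hz ⊢
      by_cases hw : w = x
      · subst hw
        rw [hx, Subst.single_left, Subst.single_left]
      · have hwy : w ≠ y := by
          rintro rfl
          exact hy (by simpa [RawProc.fv] using ⟨hz, hw⟩)
        have hne : g w ≠ x' := fun h' => hw (g.inj (h'.trans hx.symm))
        have hgw := hg w hz hw
        rw [Subst.single_of_ne hty hw hwy, Subst.single_of_ne hty' hne, hgw]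
        rw [hgw]
        exact fun h' => hwy (f.inj h')
  | choiceL R h ih =>
    cases hf with
    | sum h₁ h₂ =>
      obtain ⟨Q', hQ, hr⟩ := ih h₁
      exact ⟨Q', .choiceL _ hQ, hr⟩
  | choiceR R h ih =>
    cases hf with
    | sum h₁ h₂ =>
      obtain ⟨Q', hQ, hr⟩ := ih h₂
      exact ⟨Q', .choiceR _ hQ, hr⟩
  | intl1L hx h ih =>
    cases hf with
    | par h₁ h₂ =>
      obtain ⟨Q', hQ, hr⟩ := ih h₁
      exact ⟨_, .intl1L (by rwa [h₂.mem_fv]) hQ, .par hr h₂⟩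
  | intl1R hx h ih =>
    cases hf with
    | par h₁ h₂ =>
      obtain ⟨Q', hQ, hr⟩ := ih h₂
      exact ⟨_, .intl1R (by rwa [h₁.mem_fv]) hQ, .par h₁ hr⟩
  | intl2L R hα h ih =>
    cases hf with
    | par h₁ h₂ =>
      obtain ⟨Q', hQ, hr⟩ := ih h₁
      exact ⟨_, .intl2L _ (by simpa using hα) hQ, .par hr h₂⟩
  | intl2R R hα h ih =>
    cases hf with
    | par h₁ h₂ =>
      obtain ⟨Q', hQ, hr⟩ := ih h₂
      exact ⟨_, .intl2R _ (by simpa using hα) hQ, .par h₁ hr⟩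
  | commL k₁ k₂ ih₁ ih₂ =>
    cases hf with
    | par h₁ h₂ =>
      obtain ⟨P', hP, hr⟩ := ih₁ h₁
      obtain ⟨Q', hQ, hs⟩ := ih₂ h₂
      exact ⟨_, .commL hP hQ, .par hr hs⟩
  | commR k₁ k₂ ih₁ ih₂ =>
    cases hf with
    | par h₁ h₂ =>
      obtain ⟨P', hP, hr⟩ := ih₁ h₁
      obtain ⟨Q', hQ, hs⟩ := ih₂ h₂
      exact ⟨_, .commR hP hQ, .par hr hs⟩
  | res L hα h ih =>
    cases hf with
    | res _ h₁ =>
      obtain ⟨Q', hQ, hr⟩ := ih h₁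
      exact ⟨_, .res L (by simpa using hα) hQ, .res L hr⟩
  | @unfold A y g P P' ρ ρ' α hg hP h ih =>
    cases hf with
    | const _ hy =>
      -- The renamed constant unfolds by `f.comp g`, which sends the parameters to the renamed
      -- arguments. The two instances of the body then differ by `f`.
      obtain ⟨P₂, hP₂⟩ := exists_isSubst (f.comp g) (D.body A)
      have hr : Ren f P P₂ :=
        (hP.ren.symm.trans hP₂.ren).congr fun z _ => by simp
      obtain ⟨Q', hQ, hr'⟩ := ih hr
      exact ⟨Q', .unfold A (fun i => by rw [hy, Subst.comp_apply, hg]) hP₂ hQ, hr'⟩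

theorem Ren.exists_trans {P P' Q : RawProc S} {α : Act S} {f : Subst S}
    (hf : Ren f P Q) (h : Trans D P α P') :
    ∃ Q', Trans D Q (α.subst f) Q' ∧ Ren f P' Q' := by
  obtain ⟨ρ, ρ', h⟩ := h
  obtain ⟨Q', h1, h2⟩ := hf.exists_step h
  exact ⟨Q', h1.trans, h2⟩

/-- If a renaming of `P` has a transition, then so has `P`. -/
theorem Ren.exists_trans_inv {P Q Q' : RawProc S} {α : Act S} {f : Subst S}
    (hf : Ren f P Q) (h : Trans D Q α Q') :
    ∃ P', Trans D P (α.subst f.inv) P' ∧ Ren f P' Q' := by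
  obtain ⟨P', h1, h2⟩ := hf.symm.exists_trans h
  exact ⟨P', h1, h2.symm.congr fun _ _ => rfl⟩

/-! ### State-free bisimilarity closed under renaming, and its congruence properties -/

/-- If `α` is an input, then its variable is free neither in `P` nor in `Q`. -/
def FreshFor (α : Act S) (P Q : RawProc S) : Prop :=
  ∀ c x, α = .inp c x → x ∉ P.fv ∧ x ∉ Q.fv

theorem FreshFor.of_not_isInput {α : Act S} (hα : ¬ α.IsInput) (P Q : RawProc S) :
    FreshFor α P Q := by
  rintro c x rfl
  exact absurd trivial hα

theorem FreshFor.symm {α : Act S} {P Q : RawProc S} (h : FreshFor α P Q) : FreshFor α Q P :=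
  fun c x hα => (h c x hα).symm

theorem FreshFor.mono {α : Act S} {P Q P' Q' : RawProc S} (h : FreshFor α P Q)
    (hP : P'.fv ⊆ P.fv) (hQ : Q'.fv ⊆ Q.fv) : FreshFor α P' Q' :=
  fun c x hα => ⟨fun h' => (h c x hα).1 (hP h'), fun h' => (h c x hα).2 (hQ h')⟩

theorem FreshFor.subst_inv {α : Act S} {f : Subst S} {P Q P' Q' : RawProc S}
    (h : FreshFor α P' Q') (hP : Ren f P P') (hQ : Ren f Q Q') :
    FreshFor (α.subst f.inv) P Q := by
  rintro c x hα
  have hα' : α = .inp c (f x) := by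
    rw [← α.subst_subst_inv f, hα]
    rfl
  obtain ⟨h1, h2⟩ := h c _ hα'
  rw [hP.mem_fv] at h1
  rw [hQ.mem_fv] at h2
  exact ⟨h1, h2⟩

/-- Bisimulations on processes, without the states of the environment, that are closed under
renaming. -/
structure IsRenBisimulation (D : DefEqs S) (R : Proc S → Proc S → Prop) : Prop where
  symm : ∀ {P Q}, R P Q → R Q P
  ren : ∀ {P Q P' Q' : Proc S} {f : Subst S}, R P Q → Ren f P.1 P'.1 → Ren f Q.1 Q'.1 → R P' Q'
  transfer : ∀ {P Q : Proc S}, R P Q → ∀ {α : Act S} {P' : Proc S}, FreshFor α P.1 Q.1 →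
    Trans D P.1 α P'.1 → ∃ Q' : Proc S, Trans D Q.1 α Q'.1 ∧ R P' Q'

/-- The greatest bisimulation that is closed under renaming. -/
def RenBisimilar (D : DefEqs S) (P Q : Proc S) : Prop := ∃ R, IsRenBisimulation D R ∧ R P Q

theorem isRenBisimulation_renBisimilar (D : DefEqs S) : IsRenBisimulation D (RenBisimilar D) where
  symm := fun ⟨R, hR, h⟩ => ⟨R, hR, hR.symm h⟩
  ren := fun ⟨R, hR, h⟩ hP hQ => ⟨R, hR, hR.ren h hP hQ⟩
  transfer := fun ⟨R, hR, h⟩ _ _ hα ht =>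
    let ⟨Q', h1, h2⟩ := hR.transfer h hα ht
    ⟨Q', h1, R, hR, h2⟩

/-- The closure of a relation on processes under renaming. -/
def RenClosure (R : Proc S → Proc S → Prop) (P Q : Proc S) : Prop :=
  ∃ (f : Subst S) (P₀ Q₀ : Proc S), R P₀ Q₀ ∧ Ren f P₀.1 P.1 ∧ Ren f Q₀.1 Q.1

theorem RenClosure.of {R : Proc S → Proc S → Prop} {P Q : Proc S} (h : R P Q) :
    RenClosure R P Q :=
  ⟨.one, P, Q, h, .refl _, .refl _⟩

/-- Bisimulations up to renaming and bisimilarity. -/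
theorem RenBisimilar.of_upTo (R : Proc S → Proc S → Prop) (hs : ∀ {P Q}, R P Q → R Q P)
    (ht : ∀ {P Q : Proc S}, R P Q → ∀ {α : Act S} {P' : Proc S}, FreshFor α P.1 Q.1 →
      Trans D P.1 α P'.1 →
      ∃ Q' : Proc S, Trans D Q.1 α Q'.1 ∧ (RenClosure R P' Q' ∨ RenBisimilar D P' Q'))
    {P Q : Proc S} (h : R P Q) : RenBisimilar D P Q := by
  refine ⟨fun P Q => RenClosure R P Q ∨ RenBisimilar D P Q, ⟨?_, ?_, ?_⟩, Or.inl (.of h)⟩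
  · rintro P Q (⟨f, P₀, Q₀, h, hP, hQ⟩ | h)
    · exact .inl ⟨f, Q₀, P₀, hs h, hQ, hP⟩
    · exact .inr ((isRenBisimulation_renBisimilar D).symm h)
  · rintro P Q P' Q' g (⟨f, P₀, Q₀, h, hP, hQ⟩ | h) hP' hQ'
    · exact .inl ⟨g.comp f, P₀, Q₀, h, hP.trans hP', hQ.trans hQ'⟩
    · exact .inr ((isRenBisimulation_renBisimilar D).ren h hP' hQ')
  · rintro P Q (⟨f, P₀, Q₀, h, hP, hQ⟩ | h) α P' hα hstep
    -- The transition is pulled back along `f` to `P₀`, matched there by `Q₀`, and the answer is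
    -- pushed forward along `f`.
    · obtain ⟨P₁, hP₁, hr⟩ := hP.exists_trans_inv hstep
      obtain ⟨Q₁, hQ₁, h'⟩ :=
        ht h (P' := ⟨P₁, hP₁.wf P₀.2⟩) (hα.subst_inv hP hQ) hP₁
      obtain ⟨Q', hQ', hr'⟩ := hQ.exists_trans hQ₁
      rw [Act.subst_subst_inv] at hQ'
      refine ⟨⟨Q', hQ'.wf Q.2⟩, hQ', ?_⟩
      rcases h' with ⟨g, P₂, Q₂, h', hP₂, hQ₂⟩ | h'
      · exact .inl ⟨f.comp g, P₂, Q₂, h', hP₂.trans hr, hQ₂.trans hr'⟩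
      · exact .inr ((isRenBisimulation_renBisimilar D).ren h' hr hr')
    · obtain ⟨Q', h1, h2⟩ := (isRenBisimulation_renBisimilar D).transfer h hα hstep
      exact ⟨Q', h1, .inr h2⟩

namespace RenBisimilar

variable {P Q : Proc S}

theorem symm (h : RenBisimilar D P Q) : RenBisimilar D Q P :=
  (isRenBisimulation_renBisimilar D).symm h

theorem ren (h : RenBisimilar D P Q) {P' Q' : Proc S} {f : Subst S} (hP : Ren f P.1 P'.1)
    (hQ : Ren f Q.1 Q'.1) : RenBisimilar D P' Q' :=
  (isRenBisimulation_renBisimilar D).ren h hP hQ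

theorem transfer (h : RenBisimilar D P Q) {α : Act S} {P' : RawProc S} (hα : FreshFor α P.1 Q.1)
    (ht : Trans D P.1 α P') :
    ∃ Q' : Proc S, Trans D Q.1 α Q'.1 ∧ RenBisimilar D ⟨P', ht.wf P.2⟩ Q' :=
  (isRenBisimulation_renBisimilar D).transfer h (P' := ⟨P', ht.wf P.2⟩) hα ht

theorem of_ren (h : Ren Subst.one P.1 Q.1) : RenBisimilar D P Q := by
  refine of_upTo (fun P Q => Ren Subst.one P.1 Q.1)
    (fun h => h.symm.congr fun _ _ => rfl) (fun {P Q} h {α P'} hα ht => ?_) h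
  obtain ⟨Q', h1, h2⟩ := h.exists_trans ht
  rw [Act.subst_one] at h1
  exact ⟨⟨Q', h1.wf Q.2⟩, h1, .inl (.of h2)⟩

theorem refl (P : Proc S) : RenBisimilar D P P := of_ren (.refl _)

/-- Processes are bisimilar if each matches the transitions of the other, up to bisimilarity. -/
theorem of_match (R : Proc S → Proc S → Prop) (hs : ∀ {P Q}, R P Q → R Q P)
    (ht : ∀ {P Q : Proc S}, R P Q → ∀ {α : Act S} {P' : RawProc S}, FreshFor α P.1 Q.1 →
      ∀ h : Trans D P.1 α P', ∃ Q' : Proc S, Trans D Q.1 α Q'.1 ∧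
        RenBisimilar D ⟨P', h.wf P.2⟩ Q')
    (h : R P Q) : RenBisimilar D P Q := by
  refine of_upTo R hs (fun {P Q} h {α P'} hα hP' => ?_) h
  obtain ⟨Q', h1, h2⟩ := ht h hα hP'
  exact ⟨Q', h1, .inr h2⟩

/-- Only the input prefix uses more than the definition: both continuations undergo the same swap,
so closure under renaming applies. -/
theorem pre (h : RenBisimilar D P Q) (α : Act S) (hP : (RawProc.pre α P.1).WF)
    (hQ : (RawProc.pre α Q.1).WF) : RenBisimilar D ⟨.pre α P.1, hP⟩ ⟨.pre α Q.1, hQ⟩ := by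
  refine of_match (fun X Y => ∃ P Q : Proc S, RenBisimilar D P Q ∧ X.1 = .pre α P.1 ∧
    Y.1 = .pre α Q.1) (fun ⟨P, Q, h, hX, hY⟩ => ⟨Q, P, h.symm, hY, hX⟩) ?_ ⟨P, Q, h, rfl, rfl⟩
  rintro ⟨_, hX⟩ ⟨_, hY⟩ ⟨P, Q, h, rfl, rfl⟩ β P' hβ ht
  have ht' := ht
  obtain ⟨ρ, ρ', hs⟩ := ht'
  cases hs with
  | tau => exact ⟨Q, (Step.tau _ ρ).trans, h⟩
  | oper o => exact ⟨Q, (Step.oper o _ ρ).trans, h⟩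
  | output c x => exact ⟨Q, (Step.output c x _ ρ).trans, h⟩
  | @input c x y _ _ _ hty hy hsub =>
    obtain ⟨Q', hQ'⟩ := exists_isSubst (Subst.single x y hty) Q.1
    exact ⟨⟨Q', hQ'.ren.wf Q.2⟩, (Step.input c ρ hty (hβ c y rfl).2 hQ').trans,
      h.ren hsub.ren hQ'.ren⟩

theorem sum (h : RenBisimilar D P Q) (R : Proc S) :
    RenBisimilar D (Proc.sum P R) (Proc.sum Q R) := by
  refine of_match (fun X Y => ∃ P Q R : Proc S, RenBisimilar D P Q ∧ X = Proc.sum P R ∧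
    Y = Proc.sum Q R) (fun ⟨P, Q, R, h, hX, hY⟩ => ⟨Q, P, R, h.symm, hY, hX⟩) ?_
    ⟨P, Q, R, h, rfl, rfl⟩
  rintro _ _ ⟨P, Q, R, h, rfl, rfl⟩ α P' hα ht
  have ht' := ht
  obtain ⟨ρ, ρ', hs⟩ := ht'
  cases hs with
  | choiceL _ hs =>
    obtain ⟨Q', h1, h2⟩ := h.transfer
      (hα.mono Finset.subset_union_left Finset.subset_union_left) hs.trans
    exact ⟨Q', (Step.choiceL _ (h1.step ρ)).trans, h2⟩
  | choiceR _ hs => exact ⟨⟨P', ht.wf (Proc.sum P R).2⟩, (Step.choiceR _ hs).trans, refl _⟩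

theorem res (h : RenBisimilar D P Q) (L : Set S.Chan) :
    RenBisimilar D (Proc.res P L) (Proc.res Q L) := by
  refine of_upTo (fun X Y => ∃ P Q : Proc S, RenBisimilar D P Q ∧ X = Proc.res P L ∧
    Y = Proc.res Q L) (fun ⟨P, Q, h, hX, hY⟩ => ⟨Q, P, h.symm, hY, hX⟩) ?_ ⟨P, Q, h, rfl, rfl⟩
  rintro _ _ ⟨P, Q, h, rfl, rfl⟩ α ⟨P', hP'⟩ hα ⟨ρ, ρ', hs⟩
  cases hs with
  | res _ hL hs =>
    obtain ⟨Q', h1, h2⟩ := h.transfer hα hs.trans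
    exact ⟨Proc.res Q' L, (Step.res L hL (h1.step ρ)).trans, .inl (.of ⟨_, _, h2, rfl, rfl⟩)⟩

theorem par (h : RenBisimilar D P Q) (R : Proc S) (hP : Disjoint P.1.fv R.1.fv)
    (hQ : Disjoint Q.1.fv R.1.fv) : RenBisimilar D (Proc.par P R hP) (Proc.par Q R hQ) := by
  refine of_upTo (fun X Y => ∃ P Q R : Proc S, RenBisimilar D P Q ∧ X.1 = .par P.1 R.1 ∧
    Y.1 = .par Q.1 R.1) (fun ⟨P, Q, R, h, hX, hY⟩ => ⟨Q, P, R, h.symm, hY, hX⟩) ?_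
    ⟨P, Q, R, h, rfl, rfl⟩
  rintro ⟨_, hX⟩ ⟨_, hY⟩ ⟨P, Q, R, h, rfl, rfl⟩ α ⟨P', hP'⟩ hα ⟨ρ, ρ', hs⟩
  -- It is enough to name the components of the matching residual; their disjointness follows from
  -- preservation of well-formedness along transitions.
  suffices ∃ Q' R' : Proc S, ∃ P₁ : Proc S, Trans D (.par Q.1 R.1) α (.par Q'.1 R'.1) ∧
      RenBisimilar D P₁ Q' ∧ P' = .par P₁.1 R'.1 by
    obtain ⟨Q', R', P₁, ht, hb, rfl⟩ := this
    exact ⟨⟨_, ht.wf hY⟩, ht, .inl (.of ⟨P₁, Q', R', hb, rfl, rfl⟩)⟩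
  have hα' := hα.mono (P' := P.1) (Q' := Q.1) Finset.subset_union_left Finset.subset_union_left
  cases hs with
  | intl1L hx hs =>
    obtain ⟨Q', h1, h2⟩ := h.transfer hα' hs.trans
    exact ⟨Q', R, _, (Step.intl1L hx (h1.step ρ)).trans, h2, rfl⟩
  | intl1R hx hs =>
    -- When `R` receives, the side condition of the rule for `Q ‖ R` is that the variable is not
    -- free in `Q`. This is why matching is demanded only for inputs that are fresh for both sides.
    exact ⟨Q, ⟨_, hs.trans.wf R.2⟩, P, (Step.intl1R (hα' _ _ rfl).2 hs).trans, h, rfl⟩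
  | intl2L _ hi hs =>
    obtain ⟨Q', h1, h2⟩ := h.transfer hα' hs.trans
    exact ⟨Q', R, _, (Step.intl2L _ hi (h1.step ρ)).trans, h2, rfl⟩
  | intl2R _ hi hs =>
    exact ⟨Q, ⟨_, hs.trans.wf R.2⟩, P, (Step.intl2R _ hi hs).trans, h, rfl⟩
  | commL hs hs' =>
    -- A variable sent by `R` is free in `R`, hence free neither in `P` nor in `Q`. So the input
    -- premise of the communication is one that `Q` has to match.
    have hx := ((hs'.wf_and_fv R.2).2.2 _ _ rfl).1
    obtain ⟨Q', h1, h2⟩ := h.transfer (fun c x hc => by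
      injection hc with _ hc
      subst hc
      exact ⟨Finset.disjoint_right.mp hX.2.2 hx, Finset.disjoint_right.mp hY.2.2 hx⟩) hs.trans
    exact ⟨Q', ⟨_, hs'.trans.wf R.2⟩, _, (Step.commL (h1.step ρ) hs').trans, h2, rfl⟩
  | commR hs hs' =>
    obtain ⟨Q', h1, h2⟩ := h.transfer (.of_not_isInput id _ _) hs.trans
    exact ⟨Q', ⟨_, hs'.trans.wf R.2⟩, _, (Step.commR (h1.step ρ) hs').trans, h2, rfl⟩

/-- A substitution that instantiates the parameters by themselves fixes all free variables of the
body, so every unfolding is an `α`-variant of the body. -/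
theorem const_body (D : DefEqs S) (A : S.Const) :
    RenBisimilar D (Proc.const A (D.params A)) ⟨D.body A, D.wf A⟩ := by
  refine of_match (fun X Y => (X = Proc.const A (D.params A) ∧ Y.1 = D.body A) ∨
    (X.1 = D.body A ∧ Y = Proc.const A (D.params A))) (by tauto) ?_ (.inl ⟨rfl, rfl⟩)
  rintro ⟨X, hX⟩ ⟨Y, hY⟩ h α P' hα ht
  have ht' := ht
  obtain ⟨ρ, ρ', hs⟩ := ht'
  rcases h with ⟨h1, h2⟩ | ⟨h1, h2⟩
  · obtain rfl := congrArg Subtype.val h1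
    dsimp only at h2
    subst h2
    cases hs with
    | unfold _ hf hP hs =>
      obtain ⟨Q', hQ', hr⟩ := (hP.ren.congr (g := Subst.one) fun z hz => by
        obtain ⟨i, -, rfl⟩ := Finset.mem_map.mp (D.fv_subset A hz)
        exact (hf i).symm).symm.exists_trans hs.trans
      have hr' : Ren Subst.one P' Q' := hr
      rw [show (Subst.one : Subst S).inv = Subst.one from rfl, Act.subst_one] at hQ'
      exact ⟨⟨Q', hQ'.wf hY⟩, hQ', of_ren hr'⟩
  · obtain rfl := congrArg Subtype.val h2
    dsimp only at h1
    subst h1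
    obtain ⟨P, hP⟩ := exists_isSubst Subst.one (D.body A)
    obtain ⟨Q', hQ', hr⟩ := hP.ren.exists_trans hs.trans
    rw [Act.subst_one] at hQ'
    have ht : Trans D (Proc.const A (D.params A)).1 α Q' :=
      (Step.unfold A (fun _ => rfl) hP (hQ'.step ρ)).trans
    exact ⟨⟨Q', ht.wf trivial⟩, ht, of_ren hr⟩

end RenBisimilar

/-! ### Strong bisimilarity coincides with the state-free notion -/

/-- The zero operator, as a partial density operator. -/
noncomputable def DensityOp.zero : DensityOp S :=
  ⟨0, ContinuousLinearMap.isPositive_zero, by simp, by simp⟩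

/-- Processes are related if `R` relates them in some pair of states. By `Trans.step` a transition
seen in any state is available in the state at hand, and the closure under renaming is left to
`RenBisimilar.of_upTo`. -/
theorem IsStrongBisimulation.renBisimilar {R : Proc S × DensityOp S → Proc S × DensityOp S → Prop}
    (hR : IsStrongBisimulation D R) {P Q : Proc S} {ρ σ : DensityOp S} (h : R (P, ρ) (Q, σ)) :
    RenBisimilar D P Q := by
  refine RenBisimilar.of_upTo (fun P Q => ∃ ρ σ, R (P, ρ) (Q, σ))
    (fun ⟨ρ, σ, h⟩ => ⟨σ, ρ, hR.symm _ _ h⟩) ?_ ⟨ρ, σ, h⟩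
  rintro P Q ⟨ρ, σ, h⟩ α P' hα ht
  by_cases hi : α.IsInput
  · cases α with
    | inp c x =>
      obtain ⟨hx, hx'⟩ := hα c x rfl
      obtain ⟨Q', hQ', hy⟩ := hR.transfer_input P Q ρ σ h c x P' (ht.step ρ)
        (by rw [Finset.mem_union, not_or]; exact ⟨hx, hx'⟩)
      obtain ⟨P'', hP''⟩ := exists_isSubst (Subst.single x x rfl) P'.1
      obtain ⟨Q'', hQ''⟩ := exists_isSubst (Subst.single x x rfl) Q'.1
      -- Only the instance `y = x` of the input clause is needed. It yields `α`-variants of the two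
      -- residuals, from which the renaming closure leads back to the residuals themselves.
      have hr := hy x rfl (by simp) ⟨P'', hP''.ren.wf P'.2⟩ ⟨Q'', hQ''.ren.wf Q'.2⟩ hP'' hQ''
      exact ⟨Q', hQ'.trans, .inl ⟨_, _, _, ⟨ρ, σ, hr⟩, hP''.ren.symm, hQ''.ren.symm⟩⟩
    | _ => exact hi.elim
  · obtain ⟨Q', σ', hQ', h'⟩ := hR.transfer P Q ρ σ h α P' _ hi (ht.step ρ)
    exact ⟨Q', hQ'.trans, .inl (.of ⟨_, _, h'⟩)⟩

/-- The witnessing relation ignores the states altogether; the input clause for all `y` is closure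
under renaming. -/
theorem RenBisimilar.bisimilar {P Q : Proc S} (h : RenBisimilar D P Q) : Bisimilar D P Q := by
  refine fun ρ => ⟨fun C C' => RenBisimilar D C.1 C'.1, ⟨fun _ _ h => h.symm, ?_, ?_⟩, h⟩
  · intro P Q ρ σ h α P' ρ' hα hs
    obtain ⟨Q', h1, h2⟩ := h.transfer (.of_not_isInput hα _ _) hs.trans
    exact ⟨Q', _, h1.step σ, h2⟩
  · intro P Q ρ σ h c x P' hs hx
    rw [Finset.mem_union, not_or] at hx
    obtain ⟨Q', h1, h2⟩ := h.transfer (fun c' x' hc => by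
      injection hc with _ hc
      subst hc
      exact hx) hs.trans
    exact ⟨Q', h1.step σ, fun y hty _ P'' Q'' hP hQ => h2.ren hP.ren hQ.ren⟩

/-- The states of the environment are irrelevant for strong bisimilarity. -/
theorem bisimilar_iff {P Q : Proc S} : Bisimilar D P Q ↔ RenBisimilar D P Q :=
  -- Bisimilarity in a single state already suffices; the zero operator merely provides one.
  ⟨fun h => let ⟨_, hR, h'⟩ := h DensityOp.zero; hR.renBisimilar h', fun h => h.bisimilar⟩

theorem Bisimilar.refl (P : Proc S) : Bisimilar D P P := (RenBisimilar.refl P).bisimilar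

theorem Bisimilar.symm {P Q : Proc S} (h : Bisimilar D P Q) : Bisimilar D Q P :=
  (bisimilar_iff.mp h).symm.bisimilar

/-! ### Operation reduction: free variables and renaming -/

theorem RawProc.fv_pre_congr (α : Act S) {P Q : RawProc S} (h : Q.fv = P.fv) :
    (RawProc.pre α Q).fv = (RawProc.pre α P).fv := by
  cases α <;> simp only [RawProc.fv, h]

theorem RawProc.pres_append (t₁ t₂ : List (Act S)) (P : RawProc S) :
    P.pres (t₁ ++ t₂) = (P.pres t₂).pres t₁ :=
  List.foldr_append

theorem RawProc.fv_pres_congr (t : List (Act S)) {P Q : RawProc S} (h : Q.fv = P.fv) :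
    (Q.pres t).fv = (P.pres t).fv := by
  induction t with
  | nil => exact h
  | cons α t ih => exact RawProc.fv_pre_congr α ih

theorem RawProc.fv_pres_op (l : List (Op S)) (P : RawProc S) :
    (P.pres (l.map .op)).fv = P.fv ∪ opVars l := by
  induction l with
  | nil => exact (Finset.union_empty _).symm
  | cons o l ih =>
    change (P.pres (l.map .op)).fv ∪ o.vars = P.fv ∪ (o.vars ∪ opVars l)
    rw [ih, Finset.union_assoc, Finset.union_comm (opVars l)]

theorem StringRed.fv_eq {t t' : List (Act S)} (h : StringRed t t') (P : RawProc S) :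
    (P.pres t').fv = (P.pres t).fv := by
  induction h generalizing P with
  | operRed l hl => exact (RawProc.fv_pres_op l P).symm
  | struct t₁ t₂ h ih =>
    simp only [RawProc.pres_append]
    exact RawProc.fv_pres_congr t₁ (ih _)

theorem OpRed.fv_eq {P P' : RawProc S} (h : OpRed P P') : P'.fv = P.fv := by
  induction h with
  | act h P => exact h.fv_eq P
  | pre α h ih => exact RawProc.fv_pre_congr α ih
  | refl P => rfl
  | trans h₁ h₂ ih₁ ih₂ => exact ih₂.trans ih₁
  | _ => simp_all only [RawProc.fv]

/-- Under an input the body is renamed by some `g` that agrees with `f` on its free variables other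
than the bound one. This condition passes to `P'` because the free variables are the same. -/
theorem Ren.exists_opRed_pre {P P' : RawProc S} (hfv : P'.fv = P.fv)
    (hP : ∀ (f : Subst S) Q, Ren f P Q → ∃ Q', OpRed Q Q' ∧ Ren f P' Q') (α : Act S)
    {f : Subst S} {Q : RawProc S} (h : Ren f (.pre α P) Q) :
    ∃ Q', OpRed Q Q' ∧ Ren f (.pre α P') Q' := by
  cases h with
  | pre hα hβ h =>
    obtain ⟨Q', h1, h2⟩ := hP _ _ h
    exact ⟨_, .pre _ h1, .pre hα hβ h2⟩
  | inp c hg hx h =>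
    obtain ⟨Q', h1, h2⟩ := hP _ _ h
    exact ⟨_, .pre _ h1, .inp c (by rwa [hfv]) hx h2⟩

theorem Ren.exists_pres_op {f : Subst S} {P Q : RawProc S} (l : List (Op S))
    (h : Ren f (P.pres (l.map .op)) Q) :
    ∃ P', Q = P'.pres ((l.map (Op.subst f)).map .op) ∧ Ren f P P' := by
  induction l generalizing Q with
  | nil => exact ⟨Q, rfl, h⟩
  | cons o l ih =>
    cases h with
    | pre hα hβ h =>
      obtain ⟨P', rfl, h'⟩ := ih h
      subst hβ
      exact ⟨P', rfl, h'⟩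

theorem StringRed.exists_ren {t t' : List (Act S)} (h : StringRed t t') (P : RawProc S)
    (f : Subst S) (Q : RawProc S) (hf : Ren f (P.pres t) Q) :
    ∃ Q', OpRed Q Q' ∧ Ren f (P.pres t') Q' := by
  induction h generalizing P f Q with
  | operRed l hl =>
    obtain ⟨P', rfl, h⟩ := hf.exists_pres_op l
    exact ⟨_, .act (.operRed (l.map (Op.subst f)) (by simpa using hl)) P',
      .pre id (congrArg Act.op (compose_map_subst f l)) h⟩
  | @struct t t' t₁ t₂ h ih =>
    simp only [RawProc.pres_append] at hf ⊢
    -- The context `t₁` is peeled off one prefix at a time, since each input in it may change the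
    -- renaming that applies to the rest.
    induction t₁ generalizing f Q with
    | nil => exact ih _ f Q hf
    | cons α t₁ ih₁ =>
      exact Ren.exists_opRed_pre (RawProc.fv_pres_congr t₁ (h.fv_eq _)) ih₁ α hf

theorem OpRed.exists_ren {P P' : RawProc S} (h : OpRed P P') (f : Subst S) (Q : RawProc S)
    (hf : Ren f P Q) : ∃ Q', OpRed Q Q' ∧ Ren f P' Q' := by
  induction h generalizing f Q with
  | act h P => exact h.exists_ren P f Q hf
  | pre α h ih => exact Ren.exists_opRed_pre h.fv_eq ih α hf
  | sumL R h ih =>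
    cases hf with
    | sum h₁ h₂ =>
      obtain ⟨Q', k₁, k₂⟩ := ih _ _ h₁
      exact ⟨_, .sumL _ k₁, .sum k₂ h₂⟩
  | sumR R h ih =>
    cases hf with
    | sum h₁ h₂ =>
      obtain ⟨Q', k₁, k₂⟩ := ih _ _ h₂
      exact ⟨_, .sumR _ k₁, .sum h₁ k₂⟩
  | parL R h ih =>
    cases hf with
    | par h₁ h₂ =>
      obtain ⟨Q', k₁, k₂⟩ := ih _ _ h₁
      exact ⟨_, .parL _ k₁, .par k₂ h₂⟩
  | parR R h ih =>
    cases hf with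
    | par h₁ h₂ =>
      obtain ⟨Q', k₁, k₂⟩ := ih _ _ h₂
      exact ⟨_, .parR _ k₁, .par h₁ k₂⟩
  | res L h ih =>
    cases hf with
    | res _ h₁ =>
      obtain ⟨Q', k₁, k₂⟩ := ih _ _ h₁
      exact ⟨_, .res L k₁, .res L k₂⟩
  | refl P => exact ⟨Q, .refl Q, hf⟩
  | trans h₁ h₂ ih₁ ih₂ =>
    obtain ⟨Q', k₁, k₂⟩ := ih₁ f Q hf
    obtain ⟨Q'', m₁, m₂⟩ := ih₂ f Q' k₂
    exact ⟨Q'', .trans k₁ m₁, m₂⟩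

/-! ### Moving a chain of `≃` steps away from a finite set of variables -/

/-- The variables of `V` can be moved out of `B` by a substitution that fixes those of them
that are not in `B`. -/
theorem Subst.exists_avoiding (V B : Finset S.Var) :
    ∃ f : Subst S, (∀ v ∈ V, v ∉ B → f v = v) ∧ ∀ v ∈ V, f v ∉ B := by
  induction B using Finset.induction_on with
  | empty => exact ⟨.one, fun _ _ _ => rfl, by simp⟩
  | insert b B hb ih =>
    obtain ⟨f, h1, h2⟩ := ih
    -- As `z` is not among the images `f v`, swapping `b` with `z` affects only the `v` that `f`
    -- sends to `b`.
    obtain ⟨z, hty, hz⟩ := exists_fresh b (insert b B ∪ V.map f.perm.toEmbedding)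
    rw [Finset.mem_union, not_or] at hz
    have hfz : ∀ v ∈ V, f v ≠ z := by
      rintro v hv rfl
      exact hz.2 (Finset.mem_map_of_mem _ hv)
    refine ⟨(single b z hty).comp f, fun v hv hvb => ?_, fun v hv => ?_⟩
    · rw [Finset.mem_insert, not_or] at hvb
      rw [comp_apply, single_of_ne hty _ (hfz v hv), h1 v hv hvb.2]
      rw [h1 v hv hvb.2]
      exact hvb.1
    · rw [comp_apply]
      by_cases hfb : f v = b
      · rw [hfb, single_left]
        exact hz.1
      · rw [single_of_ne hty hfb (hfz v hv), Finset.mem_insert, not_or]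
        exact ⟨hfb, h2 v hv⟩

theorem Ren.disjoint_of_avoiding {f : Subst S} {P P' : RawProc S} (h : Ren f P P')
    {B : Finset S.Var} (hf : ∀ v ∈ P.fv, f v ∉ B) : Disjoint P'.fv B := by
  rw [Finset.disjoint_left]
  intro z hz
  rw [h.mem_fv_iff] at hz
  simpa using hf _ hz

theorem Proc.exists_ren (f : Subst S) (P : Proc S) : ∃ P' : Proc S, Ren f P.1 P'.1 :=
  let ⟨P', h⟩ := exists_isSubst f P.1
  ⟨⟨P', h.ren.wf P.2⟩, h.ren⟩

/-- `P ≃ Q`, where all processes involved have no free variables in `B`. -/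
def RedStepAvoiding (D : DefEqs S) (B : Finset S.Var) (P Q : Proc S) : Prop :=
  ∃ P₁ P₂ Q₁ Q₂ : Proc S, (Bisimilar D P P₁ ∧ OpRed P₁.1 P₂.1 ∧ Bisimilar D Q Q₁ ∧
    OpRed Q₁.1 Q₂.1 ∧ Bisimilar D P₂ Q₂) ∧ Disjoint P.1.fv B ∧ Disjoint Q.1.fv B ∧
    Disjoint P₁.1.fv B ∧ Disjoint Q₁.1.fv B

theorem Bisimilar.ren {P Q P' Q' : Proc S} {f : Subst S} (h : Bisimilar D P Q)
    (hP : Ren f P.1 P'.1) (hQ : Ren f Q.1 Q'.1) : Bisimilar D P' Q' :=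
  ((bisimilar_iff.mp h).ren hP hQ).bisimilar

/-- All four witnesses are renamed along `f`. The set `V` is chosen before `f` and `B`, so that the
sets belonging to the steps of a chain can be united and a single `f` serves all of them. -/
theorem RedStep.exists_avoiding {P Q : Proc S} (h : RedStep D P Q) :
    ∃ V : Finset S.Var, ∀ (f : Subst S) (B : Finset S.Var), (∀ v ∈ V, f v ∉ B) →
      ∀ P' Q' : Proc S, Ren f P.1 P'.1 → Ren f Q.1 Q'.1 → RedStepAvoiding D B P' Q' := by
  obtain ⟨P₁, P₂, Q₁, Q₂, h1, h2, h3, h4, h5⟩ := h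
  refine ⟨P.1.fv ∪ Q.1.fv ∪ (P₁.1.fv ∪ Q₁.1.fv), fun f B hf P' Q' hP hQ => ?_⟩
  obtain ⟨P₁', hP₁⟩ := P₁.exists_ren f
  obtain ⟨Q₁', hQ₁⟩ := Q₁.exists_ren f
  obtain ⟨P₂', k2, hP₂⟩ := h2.exists_ren f _ hP₁
  obtain ⟨Q₂', k4, hQ₂⟩ := h4.exists_ren f _ hQ₁
  refine ⟨P₁', ⟨P₂', hP₂.wf P₂.2⟩, Q₁', ⟨Q₂', hQ₂.wf Q₂.2⟩,
    ⟨h1.ren hP hP₁, k2, h3.ren hQ hQ₁, k4, h5.ren hP₂ hQ₂⟩,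
    hP.disjoint_of_avoiding fun v hv => hf v ?_, hQ.disjoint_of_avoiding fun v hv => hf v ?_,
    hP₁.disjoint_of_avoiding fun v hv => hf v ?_, hQ₁.disjoint_of_avoiding fun v hv => hf v ?_⟩ <;>
  simp [hv]

theorem RedBisimilar.exists_avoiding {P Q : Proc S} (h : RedBisimilar D P Q) :
    ∃ V : Finset S.Var, ∀ (f : Subst S) (B : Finset S.Var), (∀ v ∈ V, f v ∉ B) →
      ∀ P' Q' : Proc S, Ren f P.1 P'.1 → Ren f Q.1 Q'.1 →
        Relation.TransGen (RedStepAvoiding D B) P' Q' := by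
  induction h with
  | single h =>
    obtain ⟨V, hV⟩ := h.exists_avoiding
    exact ⟨V, fun f B hf P' Q' hP hQ => .single (hV f B hf P' Q' hP hQ)⟩
  | @tail Q R _ h ih =>
    obtain ⟨V, hV⟩ := ih
    obtain ⟨W, hW⟩ := h.exists_avoiding
    refine ⟨V ∪ W, fun f B hf P' R' hP hR => ?_⟩
    obtain ⟨Q', hQ⟩ := Q.exists_ren f
    exact .tail (hV f B (fun v hv => hf v (Finset.mem_union_left _ hv)) P' Q' hP hQ)
      (hW f B (fun v hv => hf v (Finset.mem_union_right _ hv)) Q' R' hQ hR)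

/-- The free variables of `P` and `Q` lie outside `B` and so are fixed by the substitution: the
chain is renamed inside, while its ends stay in place. -/
theorem RedBisimilar.transGen_avoiding {P Q : Proc S} (h : RedBisimilar D P Q) {B : Finset S.Var}
    (hP : Disjoint P.1.fv B) (hQ : Disjoint Q.1.fv B) :
    Relation.TransGen (RedStepAvoiding D B) P Q := by
  obtain ⟨V, hV⟩ := h.exists_avoiding
  obtain ⟨f, h1, h2⟩ := Subst.exists_avoiding (V ∪ (P.1.fv ∪ Q.1.fv)) B
  refine hV f B (fun v hv => h2 v (Finset.mem_union_left _ hv)) P Q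
    (.refl_of_fixed fun x hx => h1 x (by simp [hx]) (Finset.disjoint_left.mp hP hx))
    (.refl_of_fixed fun x hx => h1 x (by simp [hx]) (Finset.disjoint_left.mp hQ hx))

/-- Strong reduction-bisimilarity is preserved by the contexts `C` that preserve strong bisimilarity
and operation reduction, even if they apply only to processes without free variables in `B`. -/
theorem RedBisimilar.congr {B : Finset S.Var} (C : (P : Proc S) → Disjoint P.1.fv B → Proc S)
    (hb : ∀ P Q hP hQ, RenBisimilar D P Q → RenBisimilar D (C P hP) (C Q hQ))
    (hr : ∀ P Q hP hQ, OpRed P.1 Q.1 → OpRed (C P hP).1 (C Q hQ).1)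
    {P Q : Proc S} (h : RedBisimilar D P Q) (hP : Disjoint P.1.fv B) (hQ : Disjoint Q.1.fv B) :
    RedBisimilar D (C P hP) (C Q hQ) := by
  have hb' : ∀ P Q hP hQ, Bisimilar D P Q → Bisimilar D (C P hP) (C Q hQ) :=
    fun P Q hP hQ h => (hb P Q hP hQ (bisimilar_iff.mp h)).bisimilar
  have key : ∀ P Q hP hQ, RedStepAvoiding D B P Q → RedStep D (C P hP) (C Q hQ) := by
    rintro P Q hP hQ ⟨P₁, P₂, Q₁, Q₂, ⟨h1, h2, h3, h4, h5⟩, -, -, hP₁, hQ₁⟩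
    -- Operation reduction keeps the free variables, so the reducts avoid `B` as well.
    have hP₂ : Disjoint P₂.1.fv B := by rwa [h2.fv_eq]
    have hQ₂ : Disjoint Q₂.1.fv B := by rwa [h4.fv_eq]
    exact ⟨C P₁ hP₁, C P₂ hP₂, C Q₁ hQ₁, C Q₂ hQ₂, hb' _ _ _ _ h1, hr _ _ _ _ h2,
      hb' _ _ _ _ h3, hr _ _ _ _ h4, hb' _ _ _ _ h5⟩
  have h' := h.transGen_avoiding hP hQ
  clear h
  induction h' with
  | single h => exact .single (key _ _ _ _ h)
  | tail _ h ih =>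
    have hd := h
    obtain ⟨-, -, -, -, -, hd, -⟩ := hd
    exact (ih hd).tail (key _ _ _ _ h)

/-! ### Strong reduction-bisimilarity: inclusions, equivalence and congruence -/

theorem Bisimilar.redBisimilar {P Q : Proc S} (h : Bisimilar D P Q) : RedBisimilar D P Q :=
  .single ⟨P, P, Q, Q, .refl P, .refl _, .refl Q, .refl _, h⟩

theorem OpRed.redBisimilar {P P' : Proc S} (h : OpRed P.1 P'.1) : RedBisimilar D P P' :=
  .single ⟨P, P', P', P', .refl P, h, .refl P', .refl _, .refl P'⟩

theorem RedStep.symm {P Q : Proc S} (h : RedStep D P Q) : RedStep D Q P := by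
  obtain ⟨P₁, P₂, Q₁, Q₂, h1, h2, h3, h4, h5⟩ := h
  exact ⟨Q₁, Q₂, P₁, P₂, h3, h4, h1, h2, h5.symm⟩

theorem RedBisimilar.equivalence (D : DefEqs S) : Equivalence (RedBisimilar D) where
  refl P := (Bisimilar.refl P).redBisimilar
  symm {P Q} h :=
    have : Std.Symm (RedStep D) := ⟨fun _ _ => RedStep.symm⟩
    Std.Symm.symm (r := Relation.TransGen (RedStep D)) P Q h
  trans h₁ h₂ := Relation.TransGen.trans h₁ h₂

theorem Proc.ops_val (l : List (Op S)) (P : Proc S) :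
    (Proc.ops l P).1 = P.1.pres (l.map .op) := by
  induction l with
  | nil => rfl
  | cons o l ih => exact congrArg (RawProc.pre (.op o)) ih

theorem Proc.opRed_ops {l : List (Op S)} (hl : l ≠ []) (P : Proc S) :
    OpRed (Proc.ops l P).1 (Proc.op (compose l) P).1 := by
  rw [Proc.ops_val]
  exact .act (.operRed l hl) P.1

/-- One `≃` step suffices: the constant is bisimilar to its body, and the body reduces to the
right-hand side. -/
theorem RedBisimilar.const_op {l : List (Op S)} {A : S.Const} (hl : l ≠ [])
    (h : D.body A = (Proc.ops l (Proc.const A (D.params A))).1) :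
    RedBisimilar D (Proc.const A (D.params A))
      (Proc.op (compose l) (Proc.const A (D.params A))) := by
  have hb := (RenBisimilar.const_body D A).bisimilar
  simp only [h] at hb
  exact .single ⟨_, _, _, _, hb, Proc.opRed_ops hl _, .refl _, .refl _, .refl _⟩

/-- Only the output prefix restricts its continuation, to processes in which `x` is not free; hence
`B` is `{x}` there and empty otherwise. -/
theorem RedBisimilar.pre {P Q : Proc S} (h : RedBisimilar D P Q) (α : Act S)
    (hP : (RawProc.pre α P.1).WF) (hQ : (RawProc.pre α Q.1).WF) :
    RedBisimilar D ⟨.pre α P.1, hP⟩ ⟨.pre α Q.1, hQ⟩ := by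
  have key : ∀ (B : Finset S.Var)
      (hC : ∀ P : Proc S, Disjoint P.1.fv B → (RawProc.pre α P.1).WF),
      Disjoint P.1.fv B → Disjoint Q.1.fv B →
      RedBisimilar D ⟨.pre α P.1, hP⟩ ⟨.pre α Q.1, hQ⟩ := fun B hC hP hQ =>
    h.congr (fun P hP => ⟨.pre α P.1, hC P hP⟩) (fun _ _ _ _ h => h.pre α _ _)
      (fun _ _ _ _ h => .pre α h) hP hQ
  cases α with
  | out c x =>
    exact key {x} (fun P hP => ⟨P.2, Finset.disjoint_singleton_right.mp hP⟩)
      (Finset.disjoint_singleton_right.mpr hP.2) (Finset.disjoint_singleton_right.mpr hQ.2)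
  | _ =>
    exact key ∅ (fun P _ => P.2) (Finset.disjoint_empty_right _) (Finset.disjoint_empty_right _)

theorem RedBisimilar.sum {P Q : Proc S} (h : RedBisimilar D P Q) (R : Proc S) :
    RedBisimilar D (Proc.sum P R) (Proc.sum Q R) :=
  h.congr (B := ∅) (fun P _ => Proc.sum P R) (fun _ _ _ _ h => h.sum R)
    (fun _ _ _ _ h => .sumL _ h) (Finset.disjoint_empty_right _) (Finset.disjoint_empty_right _)

theorem RedBisimilar.par {P Q : Proc S} (h : RedBisimilar D P Q) (R : Proc S)
    (hP : Disjoint P.1.fv R.1.fv) (hQ : Disjoint Q.1.fv R.1.fv) :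
    RedBisimilar D (Proc.par P R hP) (Proc.par Q R hQ) :=
  h.congr (fun P hP => Proc.par P R hP) (fun _ _ _ _ h => h.par R _ _)
    (fun _ _ _ _ h => .parL _ h) hP hQ

theorem RedBisimilar.res {P Q : Proc S} (h : RedBisimilar D P Q) (L : Set S.Chan) :
    RedBisimilar D (Proc.res P L) (Proc.res Q L) :=
  h.congr (B := ∅) (fun P _ => Proc.res P L) (fun _ _ _ _ h => h.res L)
    (fun _ _ _ _ h => .res L h) (Finset.disjoint_empty_right _) (Finset.disjoint_empty_right _)

end QCCS

theorem theorem5p1 (S : Signature.{u}) (D : DefEqs S) :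
    -- strong bisimilarity implies strong reduction-bisimilarity
    (∀ P Q : Proc S, Bisimilar D P Q → RedBisimilar D P Q) ∧
    -- operation reduction implies strong reduction-bisimilarity
    (∀ P P' : Proc S, OpRed P.1 P'.1 → RedBisimilar D P P') ∧
    (∀ (l : List (Op S)), l ≠ [] → ∀ P : Proc S,
      RedBisimilar D (Proc.ops l P) (Proc.op (compose l) P)) ∧
    (∀ (l : List (Op S)) (A : S.Const), l ≠ [] →
      Finset.univ.map (D.params A) = opVars l →
      D.body A = (Proc.ops l (Proc.const A (D.params A))).1 →
      RedBisimilar D (Proc.const A (D.params A))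
        (Proc.op (compose l) (Proc.const A (D.params A)))) ∧
    -- strong reduction-bisimilarity is an equivalence relation
    Equivalence (RedBisimilar D) ∧
    -- it is preserved by prefix, choice, parallel composition and restriction
    (∀ P Q : Proc S, RedBisimilar D P Q →
      (∀ (α : Act S) (hP : (RawProc.pre α P.1).WF) (hQ : (RawProc.pre α Q.1).WF),
        RedBisimilar D ⟨RawProc.pre α P.1, hP⟩ ⟨RawProc.pre α Q.1, hQ⟩) ∧
      (∀ R : Proc S, RedBisimilar D (Proc.sum P R) (Proc.sum Q R)) ∧
      (∀ (R : Proc S) (hP : Disjoint P.1.fv R.1.fv) (hQ : Disjoint Q.1.fv R.1.fv),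
        RedBisimilar D (Proc.par P R hP) (Proc.par Q R hQ)) ∧
      (∀ L : Set S.Chan, RedBisimilar D (Proc.res P L) (Proc.res Q L))) := by
  refine ⟨fun P Q h => h.redBisimilar, fun P P' h => h.redBisimilar,
    fun l hl P => (Proc.opRed_ops hl P).redBisimilar,
    fun l A hl _ h => RedBisimilar.const_op hl h, RedBisimilar.equivalence D,
    fun P Q h => ⟨fun α hP hQ => h.pre α hP hQ, fun R => h.sum R, fun R hP hQ => h.par R hP hQ,
      fun L => h.res L⟩⟩
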